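/- **Corollary (Bound on AUC for GANs).** *Setting.* Let $\mu$ be a probability measure on a measurable space $X$ (the real distribution), and let $\mathcal G=\{g_a : a\in A\}$ be a family of probability measures on $X$ (the distributions that the generators can produce). Write $\rho_\nu$ for the density of $\nu$. Let $\mathcal F=\{f_\theta:\theta\in\Theta\}$, $\Theta\subseteq[-1,1]^p$, be a set of measurable functions $X\to\mathbb R$ such that, for constants $\Delta,L\ge 0$, (i) $-f\in\mathcal F$ and $\|f\|_\infty\le\Delta$ for all $f\in\mathcal F$; (ii) $\|f_\theta-f_{\theta'}\|_\infty\le L\|\theta-\theta'\|_2$ for all $\theta,\theta'\in\Theta$. Put $d_{\mathcal F}(\nu,\nu')=\sup_{f\in\mathcal F}\{\mathbb E_\nu f-\mathbb E_{\nu'}f\}$ and $$\|h\|_{\mathcal F,1}=\inf\Big\{\sum_{i=1}^n|w_i| : h=w_0+\sum_{i=1}^n w_if_i \text{ a.e.},\ n\in\mathbb N,\ w_i\in\mathbb R,\ f_i\in\mathcal F\Big\}.$$ Assume that for every $\nu\in\mathcal G$ the measures $\mu,\nu$ are mutually absolutely continuous and $\log(\rho_\mu/\rho_\nu)$ is a.e.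 equal to a finite linear combination of a constant and functions in $\mathcal F$, and that $\Gamma=\sup_{\nu\in\mathcal G}\|\log(\rho_\mu/\rho_\nu)\|_{\mathcal F,1}<\infty$. For $0<\delta\le1$, $m\ge1$ and $\tau_m\in\mathbb R$ put $$C_\delta=16\sqrt{2\pi}\,pL+2\Delta\sqrt{2\log(1/\delta)},\qquad \epsilon_{\mathcal F}(m,\delta)=2\Big(\inf_{\nu\in\mathcal G}d_{\mathcal F}(\mu,\nu)+\tau_m+\frac{C_\delta}{\sqrt m}\Big),\qquad \epsilon_{TV}(m,\delta)=\frac{\sqrt{\Gamma\,\epsilon_{\mathcal F}(m,\delta)}}{2\sqrt2}.$$ *Training.* Let $x_1,\dots,x_m$ be i.i.d. from $\mu$ with empirical distribution $\hat\mu_m$, and let $g_\alpha\in\mathcal G$ be the (possibly randomized) output of training, with optimization error $d_{\mathcal F}(\hat\mu_m,g_\alpha)-\inf_{\nu\in\mathcal G}d_{\mathcal F}(\hat\mu_m,\nu)\le\tau_m$ almost surely. *Attack.* An attack policy is a set of (randomized, measurable) decision rules $\varphi:X\to[0,1]$, where $\varphi(x)$ is the probability of declaring $x$ a training sample; it may depend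 on $g_\alpha$. The false positive rate is $\mathrm{FP}(\varphi)=\mathbb E_\mu\varphi$. The true positive rate is $\mathrm{TP}(\varphi)=\mathbb E\,\varphi(x)$, where $x$ is a uniformly chosen entry of a dataset drawn from the posterior law of the training set given $\alpha$, i.e. the law with density proportional to $\prod_{i=1}^m \rho_{g_\alpha}(x_i)/\rho_\mu(x_i)$ with respect to $\mu^{\otimes m}$ (the likelihood of $\alpha$ given a dataset is taken proportional to $e^{-\sum_i\ell(\alpha,x_i)}$ with $\ell(\alpha,x)=\log(\rho_\mu(x)/\rho_{g_\alpha}(x))$, the normalizing constant not depending on the dataset). The ROC curve of the policy maps $t\in[0,1]$ to the supremum of $\mathrm{TP}(\varphi)$ over its rules with $\mathrm{FP}(\varphi)\le t$ (to $0$ if there is none), and $\mathrm{AUC}$ is the integral of the ROC curve over $[0,1]$. *Conclusion.* 1. For every $m\ge1$ with $\epsilon_{TV}(m,\delta)\le1$: with probability at least $1-\delta$ over the training, every attack policy satisfies $$\mathrm{AUC}\le-\tfrac12\epsilon_{TV}(m,\delta)^2+\epsilon_{TV}(m,\delta)+\tfrac12 .$$ 2. For every $m\ge1$, $$\Big(-\tfrac12\epsilon_{TV}(m,\delta)^2+\epsilon_{TV}(m,\delta)+\tfrac12\Big)-\tfrac12\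 \le\ \tfrac12\sqrt{\Gamma\Big(\inf_{\nu\in\mathcal G}d_{\mathcal F}(\mu,\nu)+\tau_m\Big)}+\tfrac12\sqrt{\Gamma C_\delta}\;m^{-1/4},$$ where the square root of a negative number is read as $0$. If the approximation and optimization errors are negligible, i.e. $\inf_{\nu\in\mathcal G}d_{\mathcal F}(\mu,\nu)+\tau_m=O(m^{-1/2})$ as $m\to\infty$, then the excess of the AUC bound over $\tfrac12$ is $O(m^{-1/4})$ as $m\to\infty$. -/

import Mathlib

open MeasureTheory ProbabilityTheory Filter Asymptotics

noncomputable section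

namespace GANPrivacy

/-! ### Discriminator classes, integral probability metric, variation norm -/

/-- The integral probability metric
`d_F(μ, ν) = sup_{f ∈ F} (E_μ f - E_ν f)`. -/
def ipm {X : Type*} [MeasurableSpace X] (F : Set (X → ℝ)) (μ ν : Measure X) : ℝ :=
  ⨆ f : F, ((∫ x, f.1 x ∂μ) - ∫ x, f.1 x ∂ν)

/-- The numbers `∑ |w_i|` over all representations of `h` as a linear combination
`w_0 + ∑_{i < n} w_i f_i` with `f_i ∈ F`. A log density ratio is only defined up to null sets,
so the representation is required almost everywhere with respect to `μ`. -/
def variationValues {X : Type*} [MeasurableSpace X] (F : Set (X → ℝ)) (μ : Measure X)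
    (h : X → ℝ) : Set ℝ :=
  {s | ∃ (n : ℕ) (w₀ : ℝ) (w : Fin n → ℝ) (f : Fin n → X → ℝ),
      (∀ i, f i ∈ F) ∧ (h =ᵐ[μ] fun x => w₀ + ∑ i, w i * f i x) ∧ s = ∑ i, |w i|}

/-- The `F`-variation norm: the infimum of `∑ |w_i|` over all representations. -/
def variationNorm {X : Type*} [MeasurableSpace X] (F : Set (X → ℝ)) (μ : Measure X)
    (h : X → ℝ) : ℝ :=
  sInf (variationValues F μ h)

/-- `log (ρ_μ / ρ_ν) ∈ Span F`. The log density ratio is Mathlib's log-likelihood ratio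
`llr μ ν = log (dμ/dν)`, which agrees almost everywhere with `log (ρ_μ / ρ_ν)` for densities with
respect to any common dominating measure; it is finite almost everywhere exactly when the two
measures are mutually absolutely continuous. -/
def LogRatioInSpan {X : Type*} [MeasurableSpace X] (F : Set (X → ℝ)) (μ ν : Measure X) : Prop :=
  μ ≪ ν ∧ ν ≪ μ ∧ (variationValues F μ (llr μ ν)).Nonempty

/-- `Γ_{F,G,μ} = sup_{ν ∈ G} ‖log (ρ_μ / ρ_ν)‖_{F,1}`, where `G = {gen a : a}`. -/
def complexityCoeff {X A : Type*} [MeasurableSpace X] (F : Set (X → ℝ)) (gen : A → Measure X)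
    (μ : Measure X) : ℝ :=
  ⨆ a, variationNorm F μ (llr μ (gen a))

/-- The approximation error `inf_{ν ∈ G} d_F(μ, ν)`. -/
def approxError {X A : Type*} [MeasurableSpace X] (F : Set (X → ℝ)) (gen : A → Measure X)
    (μ : Measure X) : ℝ :=
  ⨅ a, ipm F μ (gen a)

/-- The empirical distribution of a dataset of `m` samples. -/
def empiricalMeasure {X : Type*} [MeasurableSpace X] {m : ℕ} (x : Fin m → X) : Measure X :=
  (m : ENNReal)⁻¹ • ∑ i, Measure.dirac (x i)

/-! ### The error quantities -/

/-- `C_δ = 16 √(2π) p L + 2 Δ √(2 log (1/δ))`. -/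
def genConst (p : ℕ) (L Δ δ : ℝ) : ℝ :=
  16 * √(2 * Real.pi) * p * L + 2 * Δ * √(2 * Real.log (1 / δ))

/-- `ε_F(m, δ) = 2 (inf_{ν ∈ G} d_F(μ, ν) + τ_opt + C_δ / √m)`. -/
def epsF {X A : Type*} [MeasurableSpace X] (F : Set (X → ℝ)) (gen : A → Measure X)
    (μ : Measure X) (p : ℕ) (L Δ τ : ℝ) (m : ℕ) (δ : ℝ) : ℝ :=
  2 * (approxError F gen μ + τ + genConst p L Δ δ / √m)

/-- `ε_TV(m, δ) = √(Γ_{F,G,μ} ε_F(m, δ)) / (2 √2)`. -/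
def epsTV {X A : Type*} [MeasurableSpace X] (F : Set (X → ℝ)) (gen : A → Measure X)
    (μ : Measure X) (p : ℕ) (L Δ τ : ℝ) (m : ℕ) (δ : ℝ) : ℝ :=
  √(complexityCoeff F gen μ * epsF F gen μ p L Δ τ m δ) / (2 * √2)

/-- The bound `-ε²/2 + ε + 1/2`. -/
def aucBound (ε : ℝ) : ℝ := -(1 / 2) * ε ^ 2 + ε + 1 / 2

/-! ### Membership inference -/

/-- The posterior law of the training dataset given that the trained generator is `ν`.
The dataset is a priori i.i.d. from `μ`, and the probability that training on `x_1, …, x_m` returns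
the generator `ν` is proportional to `exp (-∑ ℓ(ν, x_i))` with the loss
`ℓ(ν, x) = log (ρ_μ x / ρ_ν x)`. By Bayes' rule the posterior has density
`exp (-∑ ℓ(ν, x_i)) / ∫ exp (-∑ ℓ(ν, y_i)) dμ^m(y)` with respect to `μ^m`. -/
def datasetPosterior {X : Type*} [MeasurableSpace X] (μ ν : Measure X) (m : ℕ) :
    Measure (Fin m → X) :=
  (Measure.pi fun _ : Fin m => μ).tilted fun x => -∑ i, llr μ ν (x i)

/-- The posterior law of a training sample given that the trained generator is `ν`: a uniformly
chosen entry of a dataset drawn from the posterior law of the dataset. -/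
def trainPosterior {X : Type*} [MeasurableSpace X] (μ ν : Measure X) (m : ℕ) : Measure X :=
  (m : ENNReal)⁻¹ • ∑ i : Fin m, (datasetPosterior μ ν m).map fun x => x i

/-- A (randomized) decision rule: `accept x` is the probability of declaring the test sample `x` a
member of the training set. -/
structure DecisionRule (X : Type*) [MeasurableSpace X] where
  accept : X → ℝ
  measurable_accept : Measurable accept
  accept_mem : ∀ x, accept x ∈ Set.Icc (0 : ℝ) 1

/-- The probability that the decision rule declares "member" for a test sample of law `ν`. It is the
true positive rate if `ν` is the law of a training sample and the false positive rate if `ν` is the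
real distribution. -/
def DecisionRule.rate {X : Type*} [MeasurableSpace X] (φ : DecisionRule X) (ν : Measure X) : ℝ :=
  ∫ x, φ.accept x ∂ν

/-- An attack policy, as seen by its ROC curve, is the set of all its operating points (for example
all thresholds of a score, with randomized treatment of ties): an arbitrary set of decision rules. -/
abbrev AttackPolicy (X : Type*) [MeasurableSpace X] := Set (DecisionRule X)

/-- The ROC curve of an attack policy: the best true positive rate that the policy attains with
false positive rate at most `x`. Here `pos` is the law of a training sample and `neg` that of
a fresh sample. -/
def roc {X : Type*} [MeasurableSpace X] (𝒜 : AttackPolicy X) (pos neg : Measure X) (x : ℝ) : ℝ :=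
  ⨆ φ : {φ : DecisionRule X // φ ∈ 𝒜 ∧ φ.rate neg ≤ x}, φ.1.rate pos

/-- The area under the ROC curve. -/
def auc {X : Type*} [MeasurableSpace X] (𝒜 : AttackPolicy X) (pos neg : Measure X) : ℝ :=
  ∫ x in (0 : ℝ)..1, roc 𝒜 pos neg x

end GANPrivacy

end

/-!
The posterior of the training set has density `∏ ρ_ν / ρ_μ` with respect to `μ ^ m`, where `ν` is
the trained generator; so it is `ν ^ m`, and a training sample has the law `ν` a posteriori
(`trainPosterior_eq`). A membership attack is therefore a family of tests of `ν` against `μ`. If no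
test separates the two laws by more than `ε`, the ROC curve lies below `min 1 (x + ε)`, and the area
under that function is `-ε² / 2 + ε + 1 / 2` (`auc_le_aucBound`). It remains to bound the total
variation distance of `μ` and `ν` by `ε_TV`.

Let `J = E_μ ℓ - E_ν ℓ` with `ℓ = log (dμ/dν)`, the symmetrized Kullback–Leibler divergence. The
inequality `2 (r - 1)² / (r + 1) ≤ (r - 1) log r` gives, by a weighted AM-GM step, a Pinsker-type bound
of the total variation distance by `√J / 2` (`rate_sub_rate_le`). As `ℓ` lies in the span of `F`,
`J ≤ Γ d_F(μ, ν)` (`integral_sub_integral_le_variationNorm_mul`).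

Finally `d_F(μ, ν) ≤ inf_G d_F(μ, ·) + τ + 2 d_F(μ, μ̂)` by the triangle inequality
(`abs_integral_sub_integral_le_epsF`), and `d_F(μ, μ̂) ≤ C_δ / (2 √m)` with probability `1 - δ`
(`exists_measurableSet_deviation_le`). The expectation of `d_F(μ, μ̂)` is bounded by chaining along
dyadic cells of the parameter cube: the deviations are sub-Gaussian with respect to `L ‖θ - θ'‖ / √m`
without symmetrization, and the constant `8 √(2π)` leaves room for a crude summation
(`integral_iSup_deviation_le`). The fluctuation around the expectation is controlled by McDiarmid's
inequality, proved by integrating out one coordinate at a time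
(`hasSubgaussianMGF_of_bounded_differences`).
-/

namespace GANPrivacy

/-! ### McDiarmid's inequality -/

/-- Changing one coordinate at a time, bounded differences give a global bound. -/
lemma abs_sub_le_of_bounded_differences {X : Type*} {c : ℝ} :
    ∀ {m : ℕ} {G : (Fin m → X) → ℝ},
      (∀ x i y, |G (Function.update x i y) - G x| ≤ c) → ∀ x y, |G x - G y| ≤ m * c
  | 0, G, _, x, y => by simp [Subsingleton.elim x y]
  | m + 1, G, hG, x, y => by
    have h1 := abs_sub_le_of_bounded_differences (G := fun z => G (Fin.cons (x 0) z))
      (fun z i w => by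
        have := hG (Fin.cons (x 0) z) i.succ w
        rwa [← Fin.cons_update] at this) (Fin.tail x) (Fin.tail y)
    have h2 := hG y 0 (x 0)
    rw [← Fin.cons_self_tail y, Fin.update_cons_zero] at h2
    simp only [Fin.cons_self_tail] at h1 h2
    push_cast
    calc |G x - G y| ≤ _ := abs_sub_le _ (G (Fin.cons (x 0) (Fin.tail y))) _
      _ ≤ (m + 1) * c := by linarith

/-- **McDiarmid's inequality**, as a sub-Gaussian bound: a function of `m` independent variables
which changes by at most `c` when one coordinate changes is sub-Gaussian with variance proxy
`m c² / 4` around its mean. The first coordinate is integrated out last: its conditional mean has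
range of length at most `c`, so Hoeffding's lemma applies to it. -/
lemma hasSubgaussianMGF_of_bounded_differences {X : Type*} [MeasurableSpace X]
    (μ : Measure X) [IsProbabilityMeasure μ] (c : NNReal) :
    ∀ (m : ℕ) {G : (Fin m → X) → ℝ}, Measurable G →
      (∀ x i y, |G (Function.update x i y) - G x| ≤ c) →
      HasSubgaussianMGF (fun x => G x - ∫ y, G y ∂Measure.pi fun _ => μ) (m * (c / 2) ^ 2)
        (Measure.pi fun _ : Fin m => μ)
  | 0, G, hG, hd => by
    have hc : ∀ x, G x = G (fun i => i.elim0) := fun x => by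
      congr 1; exact Subsingleton.elim _ _
    have : (fun x => G x - ∫ y, G y ∂Measure.pi fun _ => μ) = fun _ => 0 := by
      funext x
      simp_rw [hc]
      simp
    rw [this]
    simp
  | m + 1, G, hG, hd => by
    have : Nonempty X := nonempty_of_isProbabilityMeasure μ
    set ν : Measure (Fin m → X) := Measure.pi fun _ => μ with hν
    set H : X → ℝ := fun y => ∫ z, G (Fin.cons y z) ∂ν with hH
    set a : ℝ := ∫ x, G x ∂Measure.pi fun _ => μ with ha
    have hmp : MeasurePreserving (MeasurableEquiv.piFinSuccAbove (fun _ => X) 0)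
        (Measure.pi fun _ : Fin (m + 1) => μ) (μ.prod ν) :=
      measurePreserving_piFinSuccAbove (fun _ => μ) 0
    have hcomp : ∀ x : Fin (m + 1) → X,
        (Fin.cons ((MeasurableEquiv.piFinSuccAbove (fun _ => X) 0 x).1)
          ((MeasurableEquiv.piFinSuccAbove (fun _ => X) 0 x).2) : Fin (m + 1) → X) = x := fun x => by
      exact Fin.cons_self_tail x
    have hGb : ∀ x y, |G x - G y| ≤ (m + 1 : ℕ) * c := abs_sub_le_of_bounded_differences hd
    -- transport of integrals to the product of the first coordinate and the others
    have htr : ∀ φ : ℝ → ℝ, ∫ x, φ (G x) ∂(Measure.pi fun _ : Fin (m + 1) => μ)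
        = ∫ q : X × (Fin m → X), φ (G (Fin.cons q.1 q.2)) ∂μ.prod ν := fun φ => by
      rw [← hmp.integral_comp (MeasurableEquiv.measurableEmbedding _)]
      simp_rw [hcomp]
    have hcons : Measurable fun q : X × (Fin m → X) => (Fin.cons q.1 q.2 : Fin (m + 1) → X) := by
      refine measurable_pi_iff.2 fun i => ?_
      refine Fin.cases ?_ (fun j => ?_) i
      · simpa using measurable_fst
      · simpa using measurable_snd.eval (a := j)
    have hG2 : Measurable fun q : X × (Fin m → X) => G (Fin.cons q.1 q.2) := hG.comp hcons
    have hGy : ∀ y, Measurable fun z : Fin m → X => G (Fin.cons y z) := fun y =>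
      hG2.comp (measurable_const.prodMk measurable_id)
    obtain ⟨x₀⟩ : Nonempty (Fin (m + 1) → X) := inferInstance
    have hGI : ∀ x, G x ∈ Set.Icc (G x₀ - (m + 1 : ℕ) * c) (G x₀ + (m + 1 : ℕ) * c) := fun x => by
      have := abs_le.1 (hGb x x₀); constructor <;> linarith
    have hint : ∀ y, Integrable (fun z => G (Fin.cons y z)) ν := fun y =>
      Integrable.of_mem_Icc _ _ (hGy y).aemeasurable (ae_of_all _ fun z => hGI _)
    have hint2 : Integrable (fun q : X × (Fin m → X) => G (Fin.cons q.1 q.2)) (μ.prod ν) :=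
      Integrable.of_mem_Icc _ _ hG2.aemeasurable (ae_of_all _ fun z => hGI _)
    have hexp : ∀ t : ℝ, Integrable (fun x => Real.exp (t * (G x - a)))
        (Measure.pi fun _ : Fin (m + 1) => μ) := fun t =>
      integrable_exp_mul_of_mem_Icc (a := G x₀ - (m + 1 : ℕ) * c - a)
        (b := G x₀ + (m + 1 : ℕ) * c - a) (hG.sub_const a).aemeasurable
        (ae_of_all _ fun x => ⟨by linarith [(hGI x).1], by linarith [(hGI x).2]⟩)
    have hexp2 : ∀ t : ℝ, Integrable
        (fun q : X × (Fin m → X) => Real.exp (t * (G (Fin.cons q.1 q.2) - a))) (μ.prod ν) := fun t =>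
      integrable_exp_mul_of_mem_Icc (a := G x₀ - (m + 1 : ℕ) * c - a)
        (b := G x₀ + (m + 1 : ℕ) * c - a) (hG2.sub_const a).aemeasurable
        (ae_of_all _ fun x => ⟨by linarith [(hGI (Fin.cons x.1 x.2)).1],
          by linarith [(hGI (Fin.cons x.1 x.2)).2]⟩)
    have hHm : Measurable H := (hG2.stronglyMeasurable.integral_prod_right).measurable
    have hHd : ∀ y y', H y - H y' ≤ c := fun y y' => by
      rw [hH]
      simp only
      rw [← integral_sub (hint y) (hint y')]
      calc ∫ z, (G (Fin.cons y z) - G (Fin.cons y' z)) ∂ν ≤ ∫ _, (c : ℝ) ∂ν := by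
            refine integral_mono ((hint y).sub (hint y')) (integrable_const _) fun z => ?_
            have := hd (Fin.cons y' z) 0 y
            rw [Fin.update_cons_zero] at this
            exact (abs_le.1 this).2
        _ = c := by simp
    have hbb : BddBelow (Set.range H) := by
      obtain ⟨y₀⟩ := ‹Nonempty X›
      exact ⟨H y₀ - c, by rintro _ ⟨y, rfl⟩; linarith [hHd y₀ y]⟩
    have hHI : ∀ y, H y ∈ Set.Icc (⨅ y, H y) ((⨅ y, H y) + c) := fun y =>
      ⟨ciInf_le hbb y, by
        have : H y - c ≤ ⨅ y, H y := le_ciInf fun y' => by linarith [hHd y y']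
        linarith⟩
    have hEH : ∫ y, H y ∂μ = a := by
      rw [ha, htr (fun t => t), integral_prod _ hint2]
    have hsub := hasSubgaussianMGF_of_mem_Icc hHm.aemeasurable (ae_of_all μ hHI)
    rw [hEH] at hsub
    refine ⟨hexp, fun t => ?_⟩
    rw [mgf, htr (fun s => Real.exp (t * (s - a))), integral_prod _ (hexp2 t)]
    have hin : ∀ y, ∫ z, Real.exp (t * (G (Fin.cons y z) - a)) ∂ν
        ≤ Real.exp (m * (c / 2) ^ 2 * t ^ 2 / 2) * Real.exp (t * (H y - a)) := fun y => by
      have ih := (hasSubgaussianMGF_of_bounded_differences μ c m (hGy y) (fun z i w => by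
        have := hd (Fin.cons y z) i.succ w
        rwa [← Fin.cons_update] at this)).mgf_le t
      have : ∀ z, Real.exp (t * (G (Fin.cons y z) - a))
          = Real.exp (t * (G (Fin.cons y z) - H y)) * Real.exp (t * (H y - a)) := fun z => by
        rw [← Real.exp_add]; ring_nf
      simp_rw [this]
      rw [integral_mul_const]
      refine mul_le_mul_of_nonneg_right ?_ (Real.exp_pos _).le
      simpa [mgf] using ih
    calc ∫ y, ∫ z, Real.exp (t * (G (Fin.cons y z) - a)) ∂ν ∂μ
        ≤ ∫ y, Real.exp (m * (c / 2) ^ 2 * t ^ 2 / 2) * Real.exp (t * (H y - a)) ∂μ :=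
          integral_mono (hexp2 t).integral_prod_left
            ((hsub.integrable_exp_mul t).const_mul _) hin
      _ = Real.exp (m * (c / 2) ^ 2 * t ^ 2 / 2) * mgf (fun y => H y - a) μ t := by
          rw [integral_const_mul, mgf]
      _ ≤ Real.exp (m * (c / 2) ^ 2 * t ^ 2 / 2) * Real.exp ((c / 2) ^ 2 * t ^ 2 / 2) := by
          refine mul_le_mul_of_nonneg_left ?_ (Real.exp_pos _).le
          simpa using hsub.mgf_le t
      _ = _ := by
          rw [← Real.exp_add]; push_cast; ring_nf

/-! ### Expected maximum of finitely many sub-Gaussian variables -/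

lemma le_sqrt_of_forall_pos {B a v : ℝ} (ha : 0 ≤ a) (hv : 0 ≤ v)
    (h : ∀ s : ℝ, 0 < s → s * B ≤ a + v * s ^ 2 / 2) : B ≤ √(2 * v * a) := by
  rcases le_or_gt B 0 with hB | hB
  · exact hB.trans (Real.sqrt_nonneg _)
  rcases hv.eq_or_lt with rfl | hv
  · have := h ((a + 1) / B) (by positivity)
    rw [div_mul_cancel₀ _ hB.ne'] at this
    linarith
  · refine Real.le_sqrt_of_sq_le ?_
    -- `B / v` is the minimizer of the quadratic in `s`
    have := h (B / v) (by positivity)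
    have e1 : B / v * B = B ^ 2 / v := by ring
    have e2 : v * (B / v) ^ 2 / 2 = B ^ 2 / v / 2 := by field_simp
    rw [e1, e2] at this
    have h3 : B ^ 2 / v ≤ 2 * a := by linarith
    rw [div_le_iff₀ hv] at h3
    linarith

lemma integrable_iSup_of_finite {Ω ι : Type*} [MeasurableSpace Ω] [Finite ι] [Nonempty ι]
    {P : Measure Ω} {V : ι → Ω → ℝ} (hm : ∀ i, Measurable (V i)) (hi : ∀ i, Integrable (V i) P) :
    Integrable (fun ω => ⨆ i, V i ω) P := by
  have := Fintype.ofFinite ι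
  refine (integrable_finsetSum Finset.univ fun i _ => (hi i).abs).mono
    (Measurable.iSup hm).aestronglyMeasurable (ae_of_all _ fun ω => ?_)
  obtain ⟨i, hi⟩ := exists_eq_ciSup_of_finite (f := fun i => V i ω)
  rw [← hi, Real.norm_eq_abs, Real.norm_of_nonneg (Finset.sum_nonneg fun i _ => abs_nonneg _)]
  exact Finset.single_le_sum (f := fun i => |V i ω|) (fun i _ => abs_nonneg _) (Finset.mem_univ i)

/-- The maximal inequality `E max ≤ √(2 v log N)` for `N` sub-Gaussian variables with variance
proxy `v`; no independence is needed. -/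
lemma integral_iSup_le_of_hasSubgaussianMGF {Ω ι : Type*} [MeasurableSpace Ω] [Fintype ι]
    [Nonempty ι] {P : Measure Ω} [IsProbabilityMeasure P] {V : ι → Ω → ℝ} {v : NNReal}
    (hm : ∀ i, Measurable (V i)) (hV : ∀ i, HasSubgaussianMGF (V i) v P) :
    ∫ ω, ⨆ i, V i ω ∂P ≤ √(2 * v * Real.log (Fintype.card ι)) := by
  have hN : 0 < (Fintype.card ι : ℝ) := by exact_mod_cast Fintype.card_pos
  refine le_sqrt_of_forall_pos
    (Real.log_nonneg (by exact_mod_cast Fintype.card_pos)) v.2 fun s hs => ?_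
  set B := Real.log (Fintype.card ι) + v * s ^ 2 / 2 with hB
  have hint := integrable_iSup_of_finite hm fun i => (hV i).integrable
  have hpt : ∀ ω, s * (⨆ i, V i ω) - B + 1 ≤ ∑ i, Real.exp (-B) * Real.exp (s * V i ω) := by
    intro ω
    obtain ⟨i, hi⟩ := exists_eq_ciSup_of_finite (f := fun i => V i ω)
    rw [← hi]
    calc s * V i ω - B + 1 ≤ Real.exp (s * V i ω - B) := Real.add_one_le_exp _
      _ = Real.exp (-B) * Real.exp (s * V i ω) := by rw [← Real.exp_add]; ring_nf
      _ ≤ _ := Finset.single_le_sum (f := fun i => Real.exp (-B) * Real.exp (s * V i ω))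
          (fun i _ => by positivity) (Finset.mem_univ i)
  have hint' : Integrable (fun ω => s * (⨆ i, V i ω) - B) P :=
    (hint.const_mul s).sub (integrable_const B)
  have hI := integral_mono (μ := P) (hint'.add (integrable_const 1))
    (integrable_finsetSum Finset.univ fun i _ => ((hV i).integrable_exp_mul s).const_mul _) hpt
  have hL : ∫ ω, (s * (⨆ i, V i ω) - B + 1) ∂P = s * ∫ ω, ⨆ i, V i ω ∂P - B + 1 := by
    rw [integral_add hint' (integrable_const 1),
      integral_sub (hint.const_mul s) (integrable_const B), integral_const_mul]
    simp
  have hR : ∫ ω, ∑ i, Real.exp (-B) * Real.exp (s * V i ω) ∂P ≤ 1 := by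
    rw [integral_finsetSum _ fun i _ => ((hV i).integrable_exp_mul s).const_mul _]
    calc ∑ i, ∫ ω, Real.exp (-B) * Real.exp (s * V i ω) ∂P
        ≤ ∑ _i : ι, Real.exp (-B) * Real.exp (v * s ^ 2 / 2) := by
          refine Finset.sum_le_sum fun i _ => ?_
          rw [integral_const_mul]
          exact mul_le_mul_of_nonneg_left ((hV i).mgf_le s) (Real.exp_pos _).le
      _ = 1 := by
          rw [Finset.sum_const, Finset.card_univ, nsmul_eq_mul, ← Real.exp_add, hB]
          have : -(Real.log (Fintype.card ι) + v * s ^ 2 / 2) + v * s ^ 2 / 2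
              = -Real.log (Fintype.card ι) := by ring
          rw [this, Real.exp_neg, Real.exp_log hN, mul_inv_cancel₀ hN.ne']
  have : s * ∫ ω, ⨆ i, V i ω ∂P - B + 1 ≤ 1 := by
    rw [← hL]; exact hI.trans hR
  linarith

/-! ### Chaining -/

/-- Chaining along nested finite partitions `c k` of the index set, the first of which is trivial:
the expected maximum of a centred process is at most the sum over the levels of the maximal
inequality for the links, plus the oscillation over the cells of the last level. -/
lemma integral_iSup_le_chaining {Ω ι : Type*} [MeasurableSpace Ω] [Finite ι] [Nonempty ι]
    {P : Measure Ω} [IsProbabilityMeasure P] {Z : ι → Ω → ℝ} (hm : ∀ i, Measurable (Z i))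
    (hi : ∀ i, Integrable (Z i) P) (h0 : ∀ i, ∫ ω, Z i ω ∂P = 0)
    {C : ℕ → Type*} [∀ k, Fintype (C k)] [∀ k, Nonempty (C k)] [Subsingleton (C 0)]
    (c : ∀ k, ι → C k) (hnest : ∀ k i j, c (k + 1) i = c (k + 1) j → c k i = c k j)
    (v : ℕ → NNReal)
    (hv : ∀ k i j, c k i = c k j → HasSubgaussianMGF (fun ω => Z i ω - Z j ω) (v k) P)
    (K : ℕ) (r : ℝ) (hr : ∀ i j, c K i = c K j → ∀ ω, Z i ω - Z j ω ≤ r) :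
    ∫ ω, ⨆ i, Z i ω ∂P
      ≤ ∑ k ∈ Finset.range K, √(2 * v k * Real.log (Fintype.card (C (k + 1)))) + r := by
  -- `rep k i` represents the level-`k` cell of `i`
  set rep : ℕ → ι → ι := fun k i => Function.invFun (c k) (c k i) with hrep
  have hcrep : ∀ k i, c k (rep k i) = c k i := fun k i => Function.invFun_eq ⟨i, rfl⟩
  have hcongr : ∀ k i j, c k i = c k j → rep k i = rep k j := fun k i j h => by
    simp only [hrep, h]
  set V : ∀ k, C (k + 1) → Ω → ℝ := fun k q ω =>
    Z (Function.invFun (c (k + 1)) q) ω - Z (rep k (Function.invFun (c (k + 1)) q)) ω with hV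
  have hVm : ∀ k q, Measurable (V k q) := fun k q => (hm _).sub (hm _)
  have hVs : ∀ k q, HasSubgaussianMGF (V k q) (v k) P := fun k q => hv k _ _ (hcrep k _).symm
  obtain ⟨i₀⟩ := ‹Nonempty ι›
  have hlink : ∀ ω i k, Z (rep k i) ω
      ≤ Z (rep 0 i₀) ω + ∑ l ∈ Finset.range k, ⨆ q, V l q ω := by
    intro ω i k
    induction k with
    | zero => simp [hcongr 0 i i₀ (Subsingleton.elim _ _)]
    | succ k ih =>
      rw [Finset.sum_range_succ]
      have h1 : V k (c (k + 1) i) ω = Z (rep (k + 1) i) ω - Z (rep k i) ω := by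
        have : rep k (rep (k + 1) i) = rep k i := hcongr k _ _ (hnest k _ _ (hcrep (k + 1) i))
        simp only [hV]
        change Z (rep (k + 1) i) ω - Z (rep k (rep (k + 1) i)) ω = _
        rw [this]
      have h2 : V k (c (k + 1) i) ω ≤ ⨆ q, V k q ω :=
        le_ciSup (f := fun q => V k q ω) (Set.finite_range _).bddAbove _
      linarith
  have hVi : ∀ k, Integrable (fun ω => ⨆ q, V k q ω) P := fun k =>
    integrable_iSup_of_finite (hVm k) fun q => (hVs k q).integrable
  have hsum : Integrable (fun ω => ∑ l ∈ Finset.range K, ⨆ q, V l q ω) P :=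
    integrable_finsetSum _ fun k _ => hVi k
  have hsum' : Integrable (fun ω => Z (rep 0 i₀) ω + ∑ l ∈ Finset.range K, ⨆ q, V l q ω) P :=
    (hi _).add hsum
  calc ∫ ω, ⨆ i, Z i ω ∂P
      ≤ ∫ ω, (Z (rep 0 i₀) ω + ∑ l ∈ Finset.range K, (⨆ q, V l q ω) + r) ∂P := by
        refine integral_mono (integrable_iSup_of_finite hm hi)
          (hsum'.add (integrable_const r)) fun ω => ciSup_le fun i => ?_
        have h1 := hr i (rep K i) (hcrep K i).symm ω
        have h2 := hlink ω i K
        linarith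
    _ = ∑ k ∈ Finset.range K, ∫ ω, ⨆ q, V k q ω ∂P + r := by
        rw [integral_add hsum' (integrable_const r), integral_add (hi _) hsum, h0,
          integral_finsetSum _ fun k _ => hVi k]
        simp
    _ ≤ _ := by
        gcongr with k _
        exact integral_iSup_le_of_hasSubgaussianMGF (hVm k) (hVs k)

/-! ### Dyadic cells of the cube -/

/-- The cell of level `k` of a point of the cube `[-1, 1]^p`: the cube of side `4` with corner
`(-1, …, -1)` is divided into `2 ^ (k p)` congruent cubes. The side `4`, instead of `2`, makes the
coordinate `1` an interior point; the minimum is idle on `[-1, 1]`. -/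
noncomputable def dyadicCell {p : ℕ} (k : ℕ) (θ : EuclideanSpace ℝ (Fin p)) : Fin p → Fin (2 ^ k) := fun j =>
  ⟨min ⌊(θ j + 1) / 4 * 2 ^ k⌋₊ (2 ^ k - 1), by
    have := Nat.one_le_two_pow (n := k); omega⟩

lemma dyadicCell_val {p : ℕ} (k : ℕ) {θ : EuclideanSpace ℝ (Fin p)}
    (hθ : ∀ i, θ i ∈ Set.Icc (-1 : ℝ) 1) (j : Fin p) :
    (dyadicCell k θ j : ℕ) = ⌊(θ j + 1) / 4 * 2 ^ k⌋₊ := by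
  refine min_eq_left (Nat.le_sub_one_of_lt ?_)
  have h2 : (0 : ℝ) < 2 ^ k := by positivity
  refine (Nat.floor_lt (mul_nonneg (by linarith [(hθ j).1]) h2.le)).2 ?_
  push_cast
  nlinarith [(hθ j).2]

lemma dyadicCell_nested {p : ℕ} (k : ℕ) {θ θ' : EuclideanSpace ℝ (Fin p)}
    (hθ : ∀ i, θ i ∈ Set.Icc (-1 : ℝ) 1) (hθ' : ∀ i, θ' i ∈ Set.Icc (-1 : ℝ) 1)
    (h : dyadicCell (k + 1) θ = dyadicCell (k + 1) θ') : dyadicCell k θ = dyadicCell k θ' := by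
  have key : ∀ u : ℝ, ⌊u * 2 ^ k⌋₊ = ⌊u * 2 ^ (k + 1)⌋₊ / 2 := fun u => by
    rw [← Nat.floor_div_ofNat]
    congr 1
    rw [pow_succ, ← mul_assoc, mul_div_assoc, div_self two_ne_zero, mul_one]
  funext j
  have hj := congrArg Fin.val (congrFun h j)
  rw [dyadicCell_val _ hθ, dyadicCell_val _ hθ'] at hj
  apply Fin.ext
  rw [dyadicCell_val _ hθ, dyadicCell_val _ hθ', key, key, hj]

lemma norm_sub_le_of_dyadicCell_eq {p : ℕ} (k : ℕ) {θ θ' : EuclideanSpace ℝ (Fin p)}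
    (hθ : ∀ i, θ i ∈ Set.Icc (-1 : ℝ) 1) (hθ' : ∀ i, θ' i ∈ Set.Icc (-1 : ℝ) 1)
    (h : dyadicCell k θ = dyadicCell k θ') : ‖θ - θ'‖ ≤ √p * (4 / 2 ^ k) := by
  have h2 : (0 : ℝ) < 2 ^ k := by positivity
  rw [EuclideanSpace.norm_eq]
  refine Real.sqrt_le_iff.2 ⟨by positivity, ?_⟩
  rw [mul_pow, Real.sq_sqrt (Nat.cast_nonneg p)]
  calc ∑ j, ‖(θ - θ') j‖ ^ 2 ≤ ∑ _j : Fin p, (4 / 2 ^ k : ℝ) ^ 2 := by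
        refine Finset.sum_le_sum fun j _ => ?_
        gcongr
        have hj := congrArg Fin.val (congrFun h j)
        rw [dyadicCell_val _ hθ, dyadicCell_val _ hθ'] at hj
        have n1 : 0 ≤ (θ j + 1) / 4 * 2 ^ k := mul_nonneg (by linarith [(hθ j).1]) h2.le
        have n2 : 0 ≤ (θ' j + 1) / 4 * 2 ^ k := mul_nonneg (by linarith [(hθ' j).1]) h2.le
        have a1 := Nat.floor_le n1
        have a2 := Nat.lt_floor_add_one ((θ j + 1) / 4 * 2 ^ k)
        have b1 := Nat.floor_le n2
        have b2 := Nat.lt_floor_add_one ((θ' j + 1) / 4 * 2 ^ k)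
        rw [hj] at a1 a2
        rw [PiLp.sub_apply, Real.norm_eq_abs, le_div_iff₀ h2, ← abs_of_pos h2, ← abs_mul, abs_le]
        constructor <;> nlinarith
    _ = p * (4 / 2 ^ k) ^ 2 := by simp

/-! ### Uniform deviations of empirical means -/

/-- The deviation `E_μ h - (h x₁ + ⋯ + h x_m) / m` of the empirical mean of `h`. -/
noncomputable def deviation {X : Type*} [MeasurableSpace X] (μ : Measure X) {m : ℕ} (h : X → ℝ)
    (x : Fin m → X) : ℝ :=
  (∫ y, h y ∂μ) - (m : ℝ)⁻¹ * ∑ j, h (x j)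

section

variable {X : Type*} [MeasurableSpace X] {μ : Measure X} {m : ℕ}

lemma measurable_deviation {h : X → ℝ} (hm : Measurable h) :
    Measurable (deviation μ h : (Fin m → X) → ℝ) :=
  measurable_const.sub
    ((Finset.measurable_sum _ fun j _ => hm.comp (measurable_pi_apply j)).const_mul _)

lemma integrable_of_abs_le [IsProbabilityMeasure μ] {h : X → ℝ} {r : ℝ} (hm : Measurable h)
    (hr : ∀ x, |h x| ≤ r) :
    Integrable h μ :=
  Integrable.of_mem_Icc (-r) r hm.aemeasurable (ae_of_all _ fun x => abs_le.1 (hr x))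

lemma deviation_sub {h g : X → ℝ} (hh : Integrable h μ) (hg : Integrable g μ) (x : Fin m → X) :
    deviation μ h x - deviation μ g x = deviation μ (fun y => h y - g y) x := by
  simp only [deviation, integral_sub hh hg, Finset.sum_sub_distrib]
  ring

lemma deviation_le [IsProbabilityMeasure μ] {h : X → ℝ} {r : ℝ} (hm : Measurable h)
    (hr : ∀ x, |h x| ≤ r) (h1 : 1 ≤ m) (x : Fin m → X) :
    deviation μ h x ≤ 2 * r := by
  have hm0 : (0 : ℝ) < m := by exact_mod_cast h1
  have a : ∫ y, h y ∂μ ≤ r := by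
    calc ∫ y, h y ∂μ ≤ ∫ _, r ∂μ :=
          integral_mono (integrable_of_abs_le hm hr) (integrable_const r)
            fun x => (abs_le.1 (hr x)).2
      _ = r := by simp
  have b : -(m * r) ≤ ∑ j, h (x j) := by
    calc -(m * r) = ∑ _j : Fin m, -r := by simp
      _ ≤ _ := Finset.sum_le_sum fun j _ => (abs_le.1 (hr (x j))).1
  have c : -r ≤ (m : ℝ)⁻¹ * ∑ j, h (x j) := by
    calc -r = (m : ℝ)⁻¹ * -(m * r) := by field_simp
      _ ≤ _ := by gcongr
  rw [deviation]
  linarith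

lemma abs_deviation_update_sub_le {h : X → ℝ} {r : ℝ} (hr : ∀ x, |h x| ≤ r)
    (x : Fin m → X) (i : Fin m) (y : X) :
    |deviation μ h (Function.update x i y) - deviation μ h x| ≤ 2 * r / m := by
  have e : deviation μ h (Function.update x i y) - deviation μ h x
      = (m : ℝ)⁻¹ * (h (x i) - h y) := by
    have hc : ∑ j, h (x j) - ∑ j, h (Function.update x i y j) = h (x i) - h y := by
      rw [← Finset.sum_sub_distrib, Finset.sum_eq_single i]
      · simp
      · intro j _ hj; simp [Function.update_of_ne hj]
      · simp
    rw [deviation, deviation, ← hc]; ring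
  rw [e, abs_mul, abs_of_nonneg (by positivity), div_eq_inv_mul]
  gcongr
  calc |h (x i) - h y| ≤ |h (x i)| + |h y| := abs_sub _ _
    _ ≤ 2 * r := by linarith [hr (x i), hr y]

lemma integral_deviation [IsProbabilityMeasure μ] {h : X → ℝ} (hh : Integrable h μ) (h1 : 1 ≤ m) :
    ∫ x, deviation μ h x ∂(Measure.pi fun _ : Fin m => μ) = 0 := by
  have hm0 : (m : ℝ) ≠ 0 := by exact_mod_cast (by omega : m ≠ 0)
  have hj : ∀ j : Fin m, Integrable (fun x : Fin m → X => h (x j)) (Measure.pi fun _ => μ) :=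
    fun j => (measurePreserving_eval (fun _ : Fin m => μ) j).integrable_comp_of_integrable hh
  have ej : ∀ j : Fin m, ∫ x : Fin m → X, h (x j) ∂(Measure.pi fun _ => μ) = ∫ y, h y ∂μ :=
    fun j => by
      have hmp := measurePreserving_eval (fun _ : Fin m => μ) j
      conv_rhs => rw [← hmp.map_eq]
      rw [integral_map hmp.measurable.aemeasurable (by rw [hmp.map_eq]; exact hh.1)]
  simp only [deviation]
  rw [integral_sub (integrable_const _) ((integrable_finsetSum _ fun j _ => hj j).const_mul _),
    integral_const_mul, integral_finsetSum _ fun j _ => hj j]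
  simp [ej, hm0]

/-- Hoeffding's inequality for a deviation, obtained from bounded differences. -/
lemma hasSubgaussianMGF_deviation [IsProbabilityMeasure μ] {h : X → ℝ} {r : ℝ} (hm : Measurable h)
    (hr : ∀ x, |h x| ≤ r) (hr0 : 0 ≤ r) (h1 : 1 ≤ m) :
    HasSubgaussianMGF (deviation μ h) (r ^ 2 / m).toNNReal (Measure.pi fun _ : Fin m => μ) := by
  have hm0 : (m : ℝ) ≠ 0 := by exact_mod_cast (by omega : m ≠ 0)
  have hc : 0 ≤ 2 * r / m := by positivity
  have := hasSubgaussianMGF_of_bounded_differences μ (2 * r / m).toNNReal m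
    (measurable_deviation (μ := μ) hm) fun x i y => by
      rw [Real.coe_toNNReal _ hc]; exact abs_deviation_update_sub_le hr x i y
  simp only [integral_deviation (integrable_of_abs_le hm hr) h1, sub_zero] at this
  convert this using 1
  apply NNReal.coe_injective
  push_cast
  rw [Real.coe_toNNReal _ hc, Real.coe_toNNReal _ (by positivity)]
  field_simp

lemma sum_range_succ_div_two_pow_le (K : ℕ) :
    ∑ k ∈ Finset.range K, ((k : ℝ) + 1) / 2 ^ k ≤ 4 := by
  have : ∀ K : ℕ, ∑ k ∈ Finset.range K, ((k : ℝ) + 1) / 2 ^ k = 4 - (2 * K + 4) / 2 ^ K := by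
    intro K
    induction K with
    | zero => norm_num
    | succ K ih =>
      rw [Finset.sum_range_succ, ih]
      push_cast
      field_simp
      ring
  rw [this]
  have : (0 : ℝ) ≤ (2 * K + 4) / 2 ^ K := by positivity
  linarith

/-- The expected uniform deviation over a finite class which is Lipschitz in a parameter from the
cube `[-1, 1]^p`. The link of the chain at level `k + 1` has `2 ^ ((k + 1) p)` values of variance
proxy `(4 √p L / 2 ^ k)² / m`; the resulting series sums to at most `16 √(2 log 2) p L / √m`,
and `4 log 2 < π`. -/
lemma integral_iSup_deviation_le [IsProbabilityMeasure μ] {ι : Type*} [Finite ι] [Nonempty ι]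
    {p : ℕ}
    (θ : ι → EuclideanSpace ℝ (Fin p)) (hθ : ∀ i j, θ i j ∈ Set.Icc (-1 : ℝ) 1)
    (h : ι → X → ℝ) (hm : ∀ i, Measurable (h i)) {Δ L : ℝ} (hL : 0 ≤ L)
    (hΔ : ∀ i x, |h i x| ≤ Δ) (hLip : ∀ i j x, |h i x - h j x| ≤ L * ‖θ i - θ j‖) (h1 : 1 ≤ m) :
    ∫ x, ⨆ i, deviation μ (h i) x ∂(Measure.pi fun _ : Fin m => μ)
      ≤ 8 * √(2 * Real.pi) * p * L / √m := by
  have hm0 : (0 : ℝ) < m := by exact_mod_cast h1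
  have hint : ∀ i, Integrable (h i) μ := fun i => integrable_of_abs_le (hm i) (hΔ i)
  set s : ℕ → ℝ := fun k => L * (√p * (4 / 2 ^ k)) with hs
  have hs0 : ∀ k, 0 ≤ s k := fun k => by positivity
  have hcell : ∀ k i j, dyadicCell k (θ i) = dyadicCell k (θ j) →
      ∀ x, |h i x - h j x| ≤ s k := fun k i j hc x =>
    (hLip i j x).trans (mul_le_mul_of_nonneg_left
      (norm_sub_le_of_dyadicCell_eq k (hθ i) (hθ j) hc) hL)
  have : Subsingleton (Fin p → Fin (2 ^ 0)) := by rw [pow_zero]; infer_instance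
  have hchain : ∀ K, ∫ x, ⨆ i, deviation μ (h i) x ∂(Measure.pi fun _ : Fin m => μ)
      ≤ 8 * √(2 * Real.pi) * p * L / √m + 2 * s K := fun K => by
    refine (integral_iSup_le_chaining (C := fun k => Fin p → Fin (2 ^ k))
      (fun i => measurable_deviation (hm i))
      (fun i => (hasSubgaussianMGF_deviation (hm i) (hΔ i)
        ((abs_nonneg _).trans (hΔ i (nonempty_of_isProbabilityMeasure μ).some)) h1).integrable)
      (fun i => integral_deviation (hint i) h1)
      (fun k i => dyadicCell k (θ i)) (fun k i j => dyadicCell_nested k (hθ i) (hθ j))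
      (fun k => (s k ^ 2 / m).toNNReal) (fun k i j hc => ?_) K (2 * s K)
      (fun i j hc x => ?_)).trans ?_
    · simp_rw [deviation_sub (hint i) (hint j)]
      exact hasSubgaussianMGF_deviation ((hm i).sub (hm j)) (hcell k i j hc) (hs0 k) h1
    · rw [deviation_sub (hint i) (hint j)]
      exact deviation_le ((hm i).sub (hm j)) (hcell K i j hc) h1 x
    · gcongr
      have hlevel : ∀ k : ℕ,
          √(2 * ((s k ^ 2 / m).toNNReal : ℝ) * Real.log (Fintype.card (Fin p → Fin (2 ^ (k + 1)))))
            ≤ 4 * √(2 * Real.log 2) * p * L / √m * (((k : ℝ) + 1) / 2 ^ k) := fun k => by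
        have hlog : 0 ≤ Real.log 2 := Real.log_nonneg one_le_two
        rw [Real.coe_toNNReal _ (by positivity)]
        simp only [Fintype.card_fun, Fintype.card_fin]
        push_cast
        rw [Real.log_pow, Real.log_pow]
        refine Real.sqrt_le_iff.2 ⟨by positivity, ?_⟩
        have e : (4 * √(2 * Real.log 2) * p * L / √m * (((k : ℝ) + 1) / 2 ^ k)) ^ 2
            = 16 * (2 * Real.log 2) * p ^ 2 * L ^ 2 / m * (((k : ℝ) + 1) ^ 2 / (2 ^ k) ^ 2) := by
          simp only [mul_pow, div_pow]
          rw [Real.sq_sqrt (by positivity), Real.sq_sqrt hm0.le]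
          ring
        have e' : 2 * (s k ^ 2 / m) * (p * (((k + 1 : ℕ) : ℝ) * Real.log 2))
            = 16 * (2 * Real.log 2) * p ^ 2 * L ^ 2 / m * (((k : ℝ) + 1) / (2 ^ k) ^ 2) := by
          simp only [hs, mul_pow, div_pow]
          rw [Real.sq_sqrt (Nat.cast_nonneg p)]
          push_cast
          ring
        rw [e, e']
        gcongr
        nlinarith [(Nat.cast_nonneg k : (0 : ℝ) ≤ k)]
      calc _ ≤ ∑ k ∈ Finset.range K,
            4 * √(2 * Real.log 2) * p * L / √m * (((k : ℝ) + 1) / 2 ^ k) :=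
            Finset.sum_le_sum fun k _ => hlevel k
        _ ≤ 4 * √(2 * Real.log 2) * p * L / √m * 4 := by
            rw [← Finset.mul_sum]
            gcongr
            exact sum_range_succ_div_two_pow_le K
        _ = 8 * (2 * √(2 * Real.log 2)) * p * L / √m := by ring
        _ ≤ _ := by
            gcongr
            refine Real.le_sqrt_of_sq_le ?_
            rw [mul_pow, Real.sq_sqrt (mul_nonneg zero_le_two (Real.log_nonneg one_le_two))]
            linarith [Real.log_two_lt_d9, Real.pi_gt_three]
  have hlim : Tendsto (fun K => 8 * √(2 * Real.pi) * p * L / √m + 2 * s K) atTop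
      (nhds (8 * √(2 * Real.pi) * p * L / √m + 2 * 0)) := by
    refine tendsto_const_nhds.add (Tendsto.const_mul 2 ?_)
    have : s = fun k => L * √p * 4 * (1 / 2 : ℝ) ^ k := by
      funext k; simp only [hs, one_div, inv_pow]; ring
    rw [this]
    simpa using (tendsto_pow_atTop_nhds_zero_of_lt_one (r := (1 / 2 : ℝ)) (by norm_num)
      (by norm_num)).const_mul (L * √p * 4)
  simpa using ge_of_tendsto' hlim hchain

/-- McDiarmid's inequality for the maximal deviation over a finite class. The threshold
`C_δ / (2 √m)` is the bound `8 √(2π) p L / √m` on the mean plus the fluctuation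
`Δ √(2 log (1/δ) / m)`. -/
lemma measure_exists_deviation_le [IsProbabilityMeasure μ] {ι : Type*} [Finite ι] [Nonempty ι]
    {p : ℕ}
    (θ : ι → EuclideanSpace ℝ (Fin p)) (hθ : ∀ i j, θ i j ∈ Set.Icc (-1 : ℝ) 1)
    (h : ι → X → ℝ) (hm : ∀ i, Measurable (h i)) {Δ L δ : ℝ} (hL : 0 ≤ L)
    (hΔ : ∀ i x, |h i x| ≤ Δ) (hLip : ∀ i j x, |h i x - h j x| ≤ L * ‖θ i - θ j‖) (h1 : 1 ≤ m)
    (hδ₀ : 0 < δ) (hδ₁ : δ ≤ 1) :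
    (Measure.pi fun _ : Fin m => μ) {x | ∃ i, genConst p L Δ δ / √m / 2 < deviation μ (h i) x}
      ≤ ENNReal.ofReal δ := by
  have hm0 : (0 : ℝ) < m := by exact_mod_cast h1
  obtain ⟨i₀⟩ := ‹Nonempty ι›
  obtain ⟨x₀⟩ := nonempty_of_isProbabilityMeasure μ
  have hΔ0 : 0 ≤ Δ := (abs_nonneg _).trans (hΔ i₀ x₀)
  set P := Measure.pi fun _ : Fin m => μ with hP
  set t := Δ * √(2 * Real.log (1 / δ)) / √m with ht
  have ht0 : 0 ≤ t := by positivity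
  have hlog : 0 ≤ Real.log (1 / δ) := Real.log_nonneg ((one_le_div hδ₀).2 hδ₁)
  have hthr : genConst p L Δ δ / √m / 2 = 8 * √(2 * Real.pi) * p * L / √m + t := by
    rw [genConst, ht]; ring
  rcases hΔ0.eq_or_lt with rfl | hΔpos
  · -- all functions vanish, and so do their deviations
    have : {x : Fin m → X | ∃ i, genConst p L 0 δ / √m / 2 < deviation μ (h i) x} = ∅ := by
      refine Set.eq_empty_of_forall_notMem fun x ⟨i, hi⟩ => ?_
      have h2 := deviation_le (μ := μ) (hm i) (hΔ i) h1 x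
      have : 0 ≤ 8 * √(2 * Real.pi) * p * L / √m + t := by positivity
      linarith
    rw [this]; simp
  set G : (Fin m → X) → ℝ := fun x => ⨆ i, deviation μ (h i) x with hG
  have hGm : Measurable G := Measurable.iSup fun i => measurable_deviation (hm i)
  have hle : ∀ i x, deviation μ (h i) x ≤ G x := fun i x =>
    le_ciSup (f := fun i => deviation μ (h i) x) (Set.finite_range _).bddAbove i
  have hc : 0 ≤ 2 * Δ / m := by positivity
  have hsub : HasSubgaussianMGF (fun x => G x - ∫ y, G y ∂P)
      (m * ((2 * Δ / m).toNNReal / 2) ^ 2) P := by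
    refine hasSubgaussianMGF_of_bounded_differences μ _ m hGm fun x i y => ?_
    rw [Real.coe_toNNReal _ hc]
    have hu := fun j => abs_le.1 (abs_deviation_update_sub_le (μ := μ) (hΔ j) x i y)
    refine abs_sub_le_iff.2 ⟨?_, ?_⟩
    · have : G (Function.update x i y) ≤ G x + 2 * Δ / m :=
        ciSup_le fun j => by linarith [hle j x, (hu j).2]
      linarith
    · have : G x ≤ G (Function.update x i y) + 2 * Δ / m :=
        ciSup_le fun j => by linarith [hle j (Function.update x i y), (hu j).1]
      linarith
  have hE := integral_iSup_deviation_le (μ := μ) θ hθ h hm hL hΔ hLip h1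
  have htail := hsub.measure_ge_le ht0
  have hval : Real.exp (-t ^ 2 / (2 * ((m * ((2 * Δ / m).toNNReal / 2) ^ 2 : NNReal) : ℝ))) = δ := by
    have e : -t ^ 2 / (2 * ((m * ((2 * Δ / m).toNNReal / 2) ^ 2 : NNReal) : ℝ))
        = -Real.log (1 / δ) := by
      push_cast
      rw [Real.coe_toNNReal _ hc, ht, div_pow, mul_pow, Real.sq_sqrt hm0.le,
        Real.sq_sqrt (by positivity)]
      field_simp
    rw [e, one_div, Real.log_inv, neg_neg, Real.exp_log hδ₀]
  rw [hval] at htail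
  calc P {x | ∃ i, genConst p L Δ δ / √m / 2 < deviation μ (h i) x}
      ≤ P {x | t ≤ G x - ∫ y, G y ∂P} := by
        refine measure_mono fun x ⟨i, hi⟩ => ?_
        have := hle i x
        change t ≤ G x - ∫ y, G y ∂P
        linarith
    _ ≤ ENNReal.ofReal δ := by
        rw [← ENNReal.ofReal_toReal (measure_ne_top P _)]
        exact ENNReal.ofReal_le_ofReal htail

/-- With probability at least `1 - δ`, the deviations of all functions of the class are at most
`C_δ / (2 √m)`. The supremum over the parameter set is exhausted by finite subsets of a countable
dense subset. -/
lemma exists_measurableSet_deviation_le [IsProbabilityMeasure μ] {p : ℕ}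
    {Θ : Set (EuclideanSpace ℝ (Fin p))}
    {f : EuclideanSpace ℝ (Fin p) → X → ℝ} (hm : ∀ θ ∈ Θ, Measurable (f θ))
    (hΘ : ∀ θ ∈ Θ, ∀ i, θ i ∈ Set.Icc (-1 : ℝ) 1) {Δ L δ : ℝ} (hL : 0 ≤ L)
    (hΔ : ∀ θ ∈ Θ, ∀ x, |f θ x| ≤ Δ)
    (hLip : ∀ θ ∈ Θ, ∀ θ' ∈ Θ, ∀ x, |f θ x - f θ' x| ≤ L * ‖θ - θ'‖) (h1 : 1 ≤ m)
    (hδ₀ : 0 < δ) (hδ₁ : δ ≤ 1) :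
    ∃ E : Set (Fin m → X), MeasurableSet E ∧
      ENNReal.ofReal (1 - δ) ≤ (Measure.pi fun _ : Fin m => μ) E ∧
      ∀ x ∈ E, ∀ θ ∈ Θ, deviation μ (f θ) x ≤ genConst p L Δ δ / √m / 2 := by
  rcases Θ.eq_empty_or_nonempty with rfl | hne
  · exact ⟨Set.univ, MeasurableSet.univ, by simp [hδ₀.le], by simp⟩
  have : Nonempty Θ := hne.to_subtype
  set P := Measure.pi fun _ : Fin m => μ with hP
  set b := genConst p L Δ δ / √m / 2 with hb
  set u : ℕ → Θ := TopologicalSpace.denseSeq Θ with hu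
  set bad : Set (Fin m → X) := ⋃ n, {x | b < deviation μ (f (u n)) x} with hbad
  have hbadm : MeasurableSet bad := MeasurableSet.iUnion fun n =>
    measurableSet_lt measurable_const (measurable_deviation (hm _ (u n).2))
  have hPbad : P bad ≤ ENNReal.ofReal δ := by
    have hacc : bad = ⋃ n : ℕ, {x | ∃ i : Fin (n + 1), b < deviation μ (f (u i)) x} := by
      ext x
      simp only [hbad, Set.mem_iUnion, Set.mem_ofPred_eq]
      exact ⟨fun ⟨n, hn⟩ => ⟨n, Fin.last n, by simpa using hn⟩, fun ⟨n, i, hi⟩ => ⟨i, hi⟩⟩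
    have hmono : Monotone fun n : ℕ =>
        {x : Fin m → X | ∃ i : Fin (n + 1), b < deviation μ (f (u i)) x} := by
      rintro n n' hnn x ⟨i, hi⟩
      exact ⟨⟨i, by omega⟩, hi⟩
    rw [hacc, hmono.measure_iUnion]
    exact iSup_le fun n => measure_exists_deviation_le (fun i : Fin (n + 1) => (u i : EuclideanSpace
      ℝ (Fin p))) (fun i => hΘ _ (u i).2) (fun i => f (u i)) (fun i => hm _ (u i).2) hL
      (fun i => hΔ _ (u i).2) (fun i j => hLip _ (u i).2 _ (u j).2) h1 hδ₀ hδ₁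
  refine ⟨badᶜ, hbadm.compl, ?_, fun x hx θ hθ => ?_⟩
  · rw [measure_compl hbadm (measure_ne_top _ _), measure_univ, ENNReal.ofReal_sub _ hδ₀.le,
      ENNReal.ofReal_one]
    exact tsub_le_tsub_left hPbad 1
  · refine le_of_forall_pos_le_add fun ε hε => ?_
    obtain ⟨n, hn⟩ := (TopologicalSpace.denseRange_denseSeq Θ).exists_dist_lt ⟨θ, hθ⟩
      (by positivity : 0 < ε / (2 * L + 1))
    rw [Subtype.dist_eq, dist_eq_norm] at hn
    have hx' : deviation μ (f (u n)) x ≤ b := by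
      by_contra hcon
      exact hx (Set.mem_iUnion.2 ⟨n, lt_of_not_ge hcon⟩)
    have hd := deviation_le (μ := μ) ((hm θ hθ).sub (hm _ (u n).2)) (hLip θ hθ _ (u n).2) h1 x
    have hs := deviation_sub (integrable_of_abs_le (μ := μ) (hm θ hθ) (hΔ θ hθ))
      (integrable_of_abs_le (μ := μ) (hm _ (u n).2) (hΔ _ (u n).2)) x
    simp only [Pi.sub_def] at hd
    rw [← hs] at hd
    have hLn : 2 * (L * ‖θ - (u n : EuclideanSpace ℝ (Fin p))‖) ≤ ε := by
      have h3 := hn.le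
      rw [le_div_iff₀ (by positivity)] at h3
      nlinarith [norm_nonneg (θ - (u n : EuclideanSpace ℝ (Fin p)))]
    linarith

end

/-! ### The posterior law of a training sample -/

/-- The density `∏ ρ_ν / ρ_μ` turns `μ ^ m` into `ν ^ m`: a posteriori the training set is
i.i.d. from the generator. -/
lemma datasetPosterior_eq_pi {X : Type*} [MeasurableSpace X] (μ ν : Measure X)
    [IsProbabilityMeasure μ] [IsProbabilityMeasure ν] (hμν : μ ≪ ν) (hνμ : ν ≪ μ) (m : ℕ) :
    datasetPosterior μ ν m = Measure.pi fun _ => ν := by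
  have hset : ∀ s : Set X, MeasurableSet s →
      ∫ x in s, Real.exp (-llr μ ν x) ∂μ = ν.real s := fun s hs => by
    rw [setIntegral_congr_ae hs ((exp_neg_llr hμν).mono fun x hx _ => hx),
      Measure.setIntegral_toReal_rnDeriv hνμ]
  have hexp : ∀ x : Fin m → X,
      Real.exp (-∑ i, llr μ ν (x i)) = ∏ i, Real.exp (-llr μ ν (x i)) := fun x => by
    rw [← Finset.sum_neg_distrib, Real.exp_sum]
  symm
  refine Measure.pi_eq fun s hs => ?_
  rw [datasetPosterior, tilted_apply_eq_ofReal_integral' _ (MeasurableSet.univ_pi hs)]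
  simp_rw [hexp]
  have h1 : ∫ x : Fin m → X, ∏ i, Real.exp (-llr μ ν (x i)) ∂Measure.pi (fun _ => μ) = 1 := by
    rw [integral_fintype_prod_eq_prod (fun (_ : Fin m) x => Real.exp (-llr μ ν x))]
    have := hset Set.univ MeasurableSet.univ
    simp only [Measure.restrict_univ] at this
    simp [this]
  rw [h1]
  simp only [div_one]
  rw [← integral_indicator (MeasurableSet.univ_pi hs)]
  have h2 : ∀ x : Fin m → X, (Set.univ.pi s).indicator
      (fun x => ∏ i, Real.exp (-llr μ ν (x i))) x
        = ∏ i, (s i).indicator (fun y => Real.exp (-llr μ ν y)) (x i) := fun x => by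
    classical
    by_cases hx : x ∈ Set.univ.pi s
    · rw [Set.indicator_of_mem hx]
      exact Finset.prod_congr rfl fun i _ => (Set.indicator_of_mem (hx i trivial)
        (fun y => Real.exp (-llr μ ν y))).symm
    · rw [Set.indicator_of_notMem hx]
      obtain ⟨i, hi⟩ : ∃ i, x i ∉ s i := by simpa [Set.mem_univ_pi] using hx
      exact (Finset.prod_eq_zero (Finset.mem_univ i) (Set.indicator_of_notMem hi _)).symm
  simp_rw [h2]
  rw [integral_fintype_prod_eq_prod
    (fun (i : Fin m) x => (s i).indicator (fun y => Real.exp (-llr μ ν y)) x),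
    ENNReal.ofReal_prod_of_nonneg fun i _ => by
      rw [integral_indicator (hs i), hset _ (hs i)]; exact measureReal_nonneg]
  refine Finset.prod_congr rfl fun i _ => ?_
  rw [integral_indicator (hs i), hset _ (hs i)]
  simp

/-- A posteriori, a training sample is distributed according to the generator. -/
lemma trainPosterior_eq {X : Type*} [MeasurableSpace X] (μ ν : Measure X)
    [IsProbabilityMeasure μ] [IsProbabilityMeasure ν] (hμν : μ ≪ ν) (hνμ : ν ≪ μ) {m : ℕ}
    (hm : 1 ≤ m) : trainPosterior μ ν m = ν := by
  have h : ∀ i : Fin m, (datasetPosterior μ ν m).map (fun x => x i) = ν := fun i => by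
    rw [datasetPosterior_eq_pi μ ν hμν hνμ]
    exact (measurePreserving_eval (fun _ : Fin m => ν) i).map_eq
  rw [trainPosterior]
  simp_rw [h]
  rw [Finset.sum_const, Finset.card_univ, Fintype.card_fin, ← Nat.cast_smul_eq_nsmul ENNReal,
    smul_smul, ENNReal.inv_mul_cancel (by simpa using by omega) (by simp), one_smul]

/-! ### Total variation and the symmetrized Kullback–Leibler divergence -/

/-- The logarithm inequality `2 (r - 1) / (r + 1) ≤ log r` for `r ≥ 1`, in a form symmetric in
`r ↦ 1 / r`, combined with an AM-GM splitting with weight `s`. -/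
lemma abs_exp_neg_sub_one_le (l s : ℝ) (hs : 0 < s) :
    |Real.exp (-l) - 1| ≤ s / 4 * ((1 - Real.exp (-l)) * l) + (Real.exp (-l) + 1) / (2 * s) := by
  set r := Real.exp (-l) with hr
  have hr0 : 0 < r := Real.exp_pos _
  have hl : l = -Real.log r := by rw [hr, Real.log_exp]; ring
  have key : 2 * (r - 1) ^ 2 / (r + 1) ≤ (1 - r) * l := by
    have pos : ∀ x : ℝ, 1 ≤ x → 2 * (x - 1) / (x + 1) ≤ Real.log x := fun x hx => by
      have h := Real.le_log_one_add_of_nonneg (x := x - 1) (by linarith)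
      have e : x - 1 + 2 = x + 1 := by ring
      rwa [add_sub_cancel, e] at h
    rw [hl]
    rcases le_total 1 r with h | h
    · have := mul_le_mul_of_nonneg_left (pos r h) (sub_nonneg.2 h)
      calc 2 * (r - 1) ^ 2 / (r + 1) = (r - 1) * (2 * (r - 1) / (r + 1)) := by ring
        _ ≤ _ := by linarith
    · have h1 := pos r⁻¹ ((one_le_inv₀ hr0).2 h)
      have := mul_le_mul_of_nonneg_left h1 (sub_nonneg.2 h)
      rw [Real.log_inv] at this
      have e : 2 * (r⁻¹ - 1) / (r⁻¹ + 1) = 2 * (1 - r) / (r + 1) := by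
        field_simp; ring
      rw [e] at this
      calc 2 * (r - 1) ^ 2 / (r + 1) = (1 - r) * (2 * (1 - r) / (r + 1)) := by ring
        _ ≤ _ := this
  have amgm : |r - 1| ≤ s / 4 * (2 * (r - 1) ^ 2 / (r + 1)) + (r + 1) / (2 * s) := by
    have h1 : s / 4 * (2 * (r - 1) ^ 2 / (r + 1)) + (r + 1) / (2 * s) - |r - 1|
        = (s * |r - 1| - (r + 1)) ^ 2 / (2 * s * (r + 1)) := by
      rw [← sq_abs (r - 1)]
      field_simp
      ring
    have h2 : 0 ≤ (s * |r - 1| - (r + 1)) ^ 2 / (2 * s * (r + 1)) := by positivity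
    linarith
  have := mul_le_mul_of_nonneg_left key (by positivity : 0 ≤ s / 4)
  linarith

/-- Any test distinguishes `μ` from `ν` by at most `√J / 2`, where `J = E_μ ℓ - E_ν ℓ` with
`ℓ = log (dμ/dν)` is the symmetrized Kullback–Leibler divergence. -/
lemma rate_sub_rate_le {X : Type*} [MeasurableSpace X] (μ ν : Measure X)
    [IsProbabilityMeasure μ] [IsProbabilityMeasure ν] (hμν : μ ≪ ν) (hνμ : ν ≪ μ)
    (hiμ : Integrable (llr μ ν) μ) (hiν : Integrable (llr μ ν) ν) (φ : DecisionRule X) :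
    φ.rate ν - φ.rate μ ≤ √((∫ x, llr μ ν x ∂μ) - ∫ x, llr μ ν x ∂ν) / 2 := by
  set J := (∫ x, llr μ ν x ∂μ) - ∫ x, llr μ ν x ∂ν with hJ
  have hr := exp_neg_llr hμν
  -- integration against `ν` is integration against `exp (-ℓ) μ`
  have chg : ∀ g : X → ℝ, ∫ x, g x ∂ν = ∫ x, Real.exp (-llr μ ν x) * g x ∂μ := fun g => by
    rw [← integral_rnDeriv_smul hνμ]
    refine integral_congr_ae (hr.mono fun x hx => ?_)
    simp only [smul_eq_mul, hx]
  have chgi : ∀ g : X → ℝ, Integrable g ν →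
      Integrable (fun x => Real.exp (-llr μ ν x) * g x) μ := fun g hg => by
    refine ((integrable_rnDeriv_smul_iff hνμ).2 hg).congr (hr.mono fun x hx => ?_)
    simp only [smul_eq_mul, hx]
  have hφ : ∀ (κ : Measure X) [IsProbabilityMeasure κ], Integrable φ.accept κ := fun κ _ =>
    Integrable.of_mem_Icc 0 1 φ.measurable_accept.aemeasurable (ae_of_all _ φ.accept_mem)
  have i1 : Integrable (fun x => Real.exp (-llr μ ν x)) μ := by
    simpa using chgi (fun _ => 1) (integrable_const 1)
  have e1 : ∫ x, Real.exp (-llr μ ν x) ∂μ = 1 := by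
    simpa using (chg fun _ => 1).symm
  have iA : Integrable (fun x => |Real.exp (-llr μ ν x) - 1|) μ :=
    (i1.sub (integrable_const 1)).abs
  have hD : φ.rate ν - φ.rate μ ≤ (∫ x, |Real.exp (-llr μ ν x) - 1| ∂μ) / 2 := by
    have i3 : Integrable (fun x => Real.exp (-llr μ ν x) * φ.accept x - φ.accept x) μ :=
      (chgi _ (hφ ν)).sub (hφ μ)
    have i4 : Integrable (fun x => (Real.exp (-llr μ ν x) - 1) * (1 / 2)) μ :=
      (i1.sub (integrable_const 1)).mul_const _
    have e2 : φ.rate ν - φ.rate μ = ∫ x, (Real.exp (-llr μ ν x) * φ.accept x - φ.accept x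
        - (Real.exp (-llr μ ν x) - 1) * (1 / 2)) ∂μ := by
      rw [integral_sub i3 i4, integral_sub (chgi _ (hφ ν)) (hφ μ), integral_mul_const,
        integral_sub i1 (integrable_const 1), e1, ← chg]
      simp [DecisionRule.rate]
    rw [e2, ← integral_div]
    refine integral_mono (i3.sub i4) (iA.div_const 2) fun x => ?_
    have h1 : |φ.accept x - 1 / 2| ≤ 1 / 2 :=
      abs_le.2 ⟨by linarith [(φ.accept_mem x).1], by linarith [(φ.accept_mem x).2]⟩
    calc Real.exp (-llr μ ν x) * φ.accept x - φ.accept x - (Real.exp (-llr μ ν x) - 1) * (1 / 2)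
        = (Real.exp (-llr μ ν x) - 1) * (φ.accept x - 1 / 2) := by ring
      _ ≤ |Real.exp (-llr μ ν x) - 1| * |φ.accept x - 1 / 2| := by
          rw [← abs_mul]; exact le_abs_self _
      _ ≤ |Real.exp (-llr μ ν x) - 1| * (1 / 2) := by gcongr
      _ = |Real.exp (-llr μ ν x) - 1| / 2 := by ring
  have hmain : ∀ s : ℝ, 0 < s → φ.rate ν - φ.rate μ ≤ s * J / 8 + 1 / (2 * s) := fun s hs => by
    have iL : Integrable (fun x => (1 - Real.exp (-llr μ ν x)) * llr μ ν x) μ := by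
      refine (hiμ.sub (chgi _ hiν)).congr (ae_of_all _ fun x => ?_)
      simp only [Pi.sub_apply]; ring
    have eL : ∫ x, (1 - Real.exp (-llr μ ν x)) * llr μ ν x ∂μ = J := by
      rw [hJ, chg, ← integral_sub hiμ (chgi _ hiν)]
      exact integral_congr_ae (ae_of_all _ fun x => by ring)
    have : ∫ x, |Real.exp (-llr μ ν x) - 1| ∂μ ≤ s / 4 * J + (1 + 1) / (2 * s) := by
      have i2 : Integrable (fun x => (Real.exp (-llr μ ν x) + 1) / (2 * s)) μ :=
        (i1.add (integrable_const 1)).div_const _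
      calc ∫ x, |Real.exp (-llr μ ν x) - 1| ∂μ
          ≤ ∫ x, (s / 4 * ((1 - Real.exp (-llr μ ν x)) * llr μ ν x)
            + (Real.exp (-llr μ ν x) + 1) / (2 * s)) ∂μ :=
            integral_mono iA ((iL.const_mul _).add i2) fun x => abs_exp_neg_sub_one_le _ s hs
        _ = _ := by
            rw [integral_add (iL.const_mul _) i2, integral_const_mul, eL, integral_div,
              integral_add i1 (integrable_const 1), e1]
            simp
    have e : (1 + 1) / (2 * s) = 2 * (1 / (2 * s)) := by ring
    rw [e] at this
    linarith
  rcases le_or_gt (φ.rate ν - φ.rate μ) 0 with h0 | h0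
  · exact h0.trans (by positivity)
  · -- the optimal weight is the reciprocal of the difference
    have h := hmain (1 / (φ.rate ν - φ.rate μ)) (by positivity)
    set D := φ.rate ν - φ.rate μ
    have e : 1 / D * J / 8 + 1 / (2 * (1 / D)) = J / (8 * D) + D / 2 := by field_simp
    rw [e] at h
    have : D / 2 ≤ J / (8 * D) := by linarith
    rw [le_div_iff₀ (by positivity)] at this
    have h2 : 2 * D ≤ √J := Real.le_sqrt_of_sq_le (by linarith)
    linarith

/-! ### From the discriminator distance to the symmetrized divergence -/

section

variable {X : Type*} [MeasurableSpace X]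

lemma nonneg_of_mem_variationValues {F : Set (X → ℝ)} {μ : Measure X} {h : X → ℝ} {s : ℝ}
    (hs : s ∈ variationValues F μ h) : 0 ≤ s := by
  obtain ⟨n, w₀, w, g, -, -, rfl⟩ := hs
  exact Finset.sum_nonneg fun i _ => abs_nonneg _

lemma variationNorm_nonneg (F : Set (X → ℝ)) (μ : Measure X) (h : X → ℝ) :
    0 ≤ variationNorm F μ h :=
  Real.sInf_nonneg fun _ hs => nonneg_of_mem_variationValues hs

lemma complexityCoeff_nonneg {A : Type*} (F : Set (X → ℝ)) (gen : A → Measure X)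
    (μ : Measure X) : 0 ≤ complexityCoeff F gen μ :=
  Real.iSup_nonneg fun _ => variationNorm_nonneg _ _ _

/-- A function in the span of `F` is integrable for both measures, and its means differ by at most
its variation norm times a common bound for the functions in `F`. -/
lemma integral_sub_integral_le_variationNorm_mul {F : Set (X → ℝ)} {μ ν : Measure X}
    [IsProbabilityMeasure μ] [IsProbabilityMeasure ν] (hνμ : ν ≪ μ) {Δ D : ℝ}
    (hFmeas : ∀ h ∈ F, Measurable h) (hBdd : ∀ h ∈ F, ∀ x, |h x| ≤ Δ) (hD : 0 ≤ D)
    (hFD : ∀ h ∈ F, |(∫ x, h x ∂μ) - ∫ x, h x ∂ν| ≤ D) {l : X → ℝ}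
    (hl : (variationValues F μ l).Nonempty) :
    Integrable l μ ∧ Integrable l ν ∧
      (∫ x, l x ∂μ) - ∫ x, l x ∂ν ≤ variationNorm F μ l * D := by
  have key : ∀ s ∈ variationValues F μ l, Integrable l μ ∧ Integrable l ν ∧
      (∫ x, l x ∂μ) - ∫ x, l x ∂ν ≤ s * D := by
    rintro s ⟨n, w₀, w, g, hg, hlg, rfl⟩
    have hi : ∀ (κ : Measure X) [IsProbabilityMeasure κ] (i : Fin n),
        Integrable (fun x => w i * g i x) κ := fun κ _ i =>
      (integrable_of_abs_le (hFmeas _ (hg i)) (hBdd _ (hg i))).const_mul _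
    have his : ∀ (κ : Measure X) [IsProbabilityMeasure κ],
        Integrable (fun x => ∑ i, w i * g i x) κ := fun κ _ =>
      integrable_finsetSum _ fun i _ => hi κ i
    have hiw : ∀ (κ : Measure X) [IsProbabilityMeasure κ],
        Integrable (fun x => w₀ + ∑ i, w i * g i x) κ := fun κ _ =>
      (integrable_const _).add (his κ)
    have he : ∀ (κ : Measure X) [IsProbabilityMeasure κ],
        ∫ x, (w₀ + ∑ i, w i * g i x) ∂κ = w₀ + ∑ i, w i * ∫ x, g i x ∂κ := fun κ _ => by
      rw [integral_add (integrable_const _) (his κ), integral_finsetSum _ fun i _ => hi κ i]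
      simp [integral_const_mul]
    have hlν := hνμ.ae_eq hlg
    refine ⟨(hiw μ).congr hlg.symm, (hiw ν).congr hlν.symm, ?_⟩
    rw [integral_congr_ae hlg, integral_congr_ae hlν, he, he, add_sub_add_left_eq_sub,
      ← Finset.sum_sub_distrib, Finset.sum_mul]
    refine Finset.sum_le_sum fun i _ => ?_
    rw [← mul_sub]
    refine (le_abs_self _).trans ?_
    rw [abs_mul]
    exact mul_le_mul_of_nonneg_left (hFD _ (hg i)) (abs_nonneg _)
  obtain ⟨s₀, hs₀⟩ := hl
  refine ⟨(key _ hs₀).1, (key _ hs₀).2.1, ?_⟩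
  rcases hD.eq_or_lt with rfl | hD'
  · simpa using (key _ hs₀).2.2
  · rw [← div_le_iff₀ hD']
    refine le_csInf ⟨s₀, hs₀⟩ fun s hs => ?_
    rw [div_le_iff₀ hD']
    exact (key s hs).2.2

/-! ### The area under the ROC curve -/

lemma DecisionRule.rate_nonneg (φ : DecisionRule X) (ν : Measure X) : 0 ≤ φ.rate ν :=
  integral_nonneg fun x => (φ.accept_mem x).1

lemma DecisionRule.rate_le_one (φ : DecisionRule X) (ν : Measure X) [IsProbabilityMeasure ν] :
    φ.rate ν ≤ 1 := by
  calc φ.rate ν ≤ ∫ _, (1 : ℝ) ∂ν :=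
        integral_mono (Integrable.of_mem_Icc 0 1 φ.measurable_accept.aemeasurable
          (ae_of_all _ φ.accept_mem)) (integrable_const 1) fun x => (φ.accept_mem x).2
    _ = 1 := by simp

lemma monotone_roc (𝒜 : AttackPolicy X) (pos neg : Measure X) [IsProbabilityMeasure pos] :
    Monotone (roc 𝒜 pos neg) := fun x y hxy => by
  refine Real.iSup_le (fun φ => ?_) (Real.iSup_nonneg fun φ => φ.1.rate_nonneg _)
  exact le_ciSup (f := fun φ : {φ : DecisionRule X // φ ∈ 𝒜 ∧ φ.rate neg ≤ y} => φ.1.rate pos)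
    ⟨1, by rintro _ ⟨ψ, rfl⟩; exact ψ.1.rate_le_one _⟩ ⟨φ.1, φ.2.1, φ.2.2.trans hxy⟩

/-- If no test separates the two laws by more than `ε`, the ROC curve lies below
`min 1 (x + ε)`, the area under which is `-ε² / 2 + ε + 1 / 2`. -/
lemma auc_le_aucBound (𝒜 : AttackPolicy X) (pos neg : Measure X) [IsProbabilityMeasure pos]
    {ε : ℝ} (h0 : 0 ≤ ε) (h1 : ε ≤ 1)
    (h : ∀ φ : DecisionRule X, φ.rate pos - φ.rate neg ≤ ε) :
    auc 𝒜 pos neg ≤ aucBound ε := by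
  have hi : ∀ a b, IntervalIntegrable (roc 𝒜 pos neg) volume a b := fun a b =>
    (monotone_roc 𝒜 pos neg).intervalIntegrable
  rw [auc, ← intervalIntegral.integral_add_adjacent_intervals (hi 0 (1 - ε)) (hi (1 - ε) 1)]
  have ha : ∫ x in (0 : ℝ)..(1 - ε), roc 𝒜 pos neg x ≤ ∫ x in (0 : ℝ)..(1 - ε), (x + ε) := by
    refine intervalIntegral.integral_mono_on (by linarith) (hi _ _)
      ((continuous_id.add continuous_const).intervalIntegrable _ _) fun x hx => ?_
    exact Real.iSup_le (fun φ => by linarith [h φ.1, φ.2.2]) (by linarith [hx.1])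
  have hb : ∫ x in (1 - ε)..1, roc 𝒜 pos neg x ≤ ∫ _x in (1 - ε)..1, (1 : ℝ) := by
    refine intervalIntegral.integral_mono_on (by linarith) (hi _ _)
      (continuous_const.intervalIntegrable _ _) fun x _ => ?_
    exact Real.iSup_le (fun φ => φ.1.rate_le_one _) zero_le_one
  have ea : ∫ x in (0 : ℝ)..(1 - ε), (x + ε) = (1 - ε) ^ 2 / 2 + (1 - ε) * ε := by
    rw [intervalIntegral.integral_add intervalIntegral.intervalIntegrable_id
      (continuous_const.intervalIntegrable _ _), integral_id]
    simp
  rw [ea] at ha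
  rw [intervalIntegral.integral_const, smul_eq_mul] at hb
  rw [aucBound]
  linarith

/-! ### Generalization of the trained generator -/

lemma integral_empiricalMeasure {m : ℕ} {h : X → ℝ} (hm : Measurable h) (x : Fin m → X) :
    ∫ y, h y ∂empiricalMeasure x = (m : ℝ)⁻¹ * ∑ j, h (x j) := by
  rw [empiricalMeasure, integral_smul_measure, integral_finsetSum_measure]
  · simp [integral_dirac' _ _ hm.stronglyMeasurable]
  · intro j _
    exact integrable_dirac' hm.stronglyMeasurable (by simp)

/-- The bound `B` only serves to make the supremum a genuine one. -/
lemma le_ipm {F : Set (X → ℝ)} {κ ν : Measure X} {B : ℝ}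
    (hB : ∀ h ∈ F, (∫ x, h x ∂κ) - ∫ x, h x ∂ν ≤ B) {h : X → ℝ} (hh : h ∈ F) :
    (∫ x, h x ∂κ) - ∫ x, h x ∂ν ≤ ipm F κ ν :=
  le_ciSup (f := fun g : F => (∫ x, g.1 x ∂κ) - ∫ x, g.1 x ∂ν)
    ⟨B, by rintro _ ⟨g, rfl⟩; exact hB g.1 g.2⟩ ⟨h, hh⟩

lemma ipm_nonneg {F : Set (X → ℝ)} {κ ν : Measure X} {B : ℝ} (hEven : ∀ h ∈ F, -h ∈ F)
    (hB : ∀ h ∈ F, (∫ x, h x ∂κ) - ∫ x, h x ∂ν ≤ B) : 0 ≤ ipm F κ ν := by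
  rcases F.eq_empty_or_nonempty with rfl | ⟨h, hh⟩
  · exact (Real.iSup_of_isEmpty _).ge
  · have h1 := le_ipm hB hh
    have h2 := le_ipm hB (hEven h hh)
    simp only [Pi.neg_apply, integral_neg] at h2
    linarith

/-- On a sample with small uniform deviations, a generator that is nearly optimal for the empirical
distribution is nearly optimal for the real distribution: the triangle inequality for `d_F` is used
once for the trained generator and once for the competitors, which doubles the deviation. -/
lemma abs_integral_sub_integral_le_epsF {A : Type*} {F : Set (X → ℝ)} {μ : Measure X}
    [IsProbabilityMeasure μ] {gen : A → Measure X} [∀ a, IsProbabilityMeasure (gen a)] {p m : ℕ}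
    {Δ L δ τ : ℝ} (hFmeas : ∀ h ∈ F, Measurable h) (hEven : ∀ h ∈ F, -h ∈ F)
    (hBdd : ∀ h ∈ F, ∀ x, |h x| ≤ Δ) {x : Fin m → X}
    (hdev : ∀ h ∈ F, deviation μ h x ≤ genConst p L Δ δ / √m / 2) {a : A}
    (hopt : ipm F (empiricalMeasure x) (gen a) - (⨅ b, ipm F (empiricalMeasure x) (gen b)) ≤ τ)
    {h : X → ℝ} (hh : h ∈ F) :
    |(∫ y, h y ∂μ) - ∫ y, h y ∂gen a| ≤ epsF F gen μ p L Δ τ m δ / 2 := by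
  set b := genConst p L Δ δ / √m / 2 with hb
  have hdev' : ∀ g ∈ F, (∫ y, g y ∂μ) - ∫ y, g y ∂empiricalMeasure x ≤ b := fun g hg => by
    rw [integral_empiricalMeasure (hFmeas g hg)]; exact hdev g hg
  have hdev'' : ∀ g ∈ F, (∫ y, g y ∂empiricalMeasure x) - ∫ y, g y ∂μ ≤ b := fun g hg => by
    have := hdev' _ (hEven g hg)
    simp only [Pi.neg_apply, integral_neg] at this
    linarith
  have habs : ∀ (κ : Measure X) [IsProbabilityMeasure κ], ∀ g ∈ F, |∫ y, g y ∂κ| ≤ Δ :=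
    fun κ _ g hg => by
      have hg' : ∀ᵐ y ∂κ, ‖g y‖ ≤ Δ := ae_of_all κ (hBdd g hg)
      simpa using norm_integral_le_of_norm_le_const hg'
  have hBμ : ∀ c, ∀ g ∈ F, (∫ y, g y ∂μ) - ∫ y, g y ∂gen c ≤ 2 * Δ := fun c g hg => by
    linarith [(abs_le.1 (habs μ g hg)).2, (abs_le.1 (habs (gen c) g hg)).1]
  have hBe : ∀ c, ∀ g ∈ F, (∫ y, g y ∂empiricalMeasure x) - ∫ y, g y ∂gen c ≤ b + 2 * Δ :=
    fun c g hg => by linarith [hBμ c g hg, hdev'' g hg]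
  have hinf : (⨅ c, ipm F (empiricalMeasure x) (gen c)) ≤ b + approxError F gen μ := by
    have : Nonempty A := ⟨a⟩
    have hF : Nonempty F := ⟨⟨h, hh⟩⟩
    rw [← sub_le_iff_le_add']
    refine le_ciInf fun c => ?_
    have h1 : (⨅ c, ipm F (empiricalMeasure x) (gen c)) ≤ ipm F (empiricalMeasure x) (gen c) :=
      ciInf_le ⟨0, by rintro _ ⟨c, rfl⟩; exact ipm_nonneg hEven (hBe c)⟩ c
    have h2 : ipm F (empiricalMeasure x) (gen c) ≤ b + ipm F μ (gen c) :=
      ciSup_le fun g => by linarith [hdev'' g.1 g.2, le_ipm (hBμ c) g.2]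
    linarith
  have key : ∀ g ∈ F, (∫ y, g y ∂μ) - ∫ y, g y ∂gen a ≤ epsF F gen μ p L Δ τ m δ / 2 :=
    fun g hg => by
      have h1 := le_ipm (hBe a) hg
      have h2 := hdev' g hg
      rw [epsF]
      have : genConst p L Δ δ / √m = 2 * b := by rw [hb]; ring
      rw [this]
      linarith
  refine abs_le.2 ⟨?_, key h hh⟩
  have := key _ (hEven h hh)
  simp only [Pi.neg_apply, integral_neg] at this
  linarith

end

/-! ### The size of the bound -/

section

variable {X A : Type*} [MeasurableSpace X]

lemma epsTV_eq (F : Set (X → ℝ)) (gen : A → Measure X) (μ : Measure X) (p : ℕ) (L Δ τ : ℝ)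
    (m : ℕ) (δ : ℝ) : epsTV F gen μ p L Δ τ m δ =
      √(complexityCoeff F gen μ * (epsF F gen μ p L Δ τ m δ / 2)) / 2 := by
  have : complexityCoeff F gen μ * epsF F gen μ p L Δ τ m δ
      = 2 * (complexityCoeff F gen μ * (epsF F gen μ p L Δ τ m δ / 2)) := by ring
  rw [epsTV, this, Real.sqrt_mul zero_le_two]
  field_simp

lemma epsTV_nonneg (F : Set (X → ℝ)) (gen : A → Measure X) (μ : Measure X) (p : ℕ) (L Δ τ : ℝ)
    (m : ℕ) (δ : ℝ) : 0 ≤ epsTV F gen μ p L Δ τ m δ := by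
  rw [epsTV]; positivity

/-- Subadditivity of the square root, read as `0` on negative numbers. -/
lemma sqrt_add_le_sqrt_add_sqrt (a b : ℝ) : √(a + b) ≤ √a + √b := by
  rcases le_or_gt a 0 with ha | ha
  · exact (Real.sqrt_le_sqrt (by linarith : a + b ≤ b)).trans (by linarith [Real.sqrt_nonneg a])
  rcases le_or_gt b 0 with hb | hb
  · exact (Real.sqrt_le_sqrt (by linarith : a + b ≤ a)).trans (by linarith [Real.sqrt_nonneg b])
  exact Real.sqrt_le_iff.2 ⟨by positivity, by
    nlinarith [Real.sq_sqrt ha.le, Real.sq_sqrt hb.le, Real.sqrt_nonneg a, Real.sqrt_nonneg b]⟩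

lemma sqrt_div_sqrt_natCast (a : ℝ) (m : ℕ) : √(a / √m) = √a * (m : ℝ) ^ (-(1 / 4) : ℝ) := by
  have hm : (0 : ℝ) ≤ m := Nat.cast_nonneg m
  have e : (1 / 4 : ℝ) = 1 / 2 * (1 / 2) := by norm_num
  rw [Real.sqrt_div' _ (Real.sqrt_nonneg _), Real.rpow_neg hm, e, Real.rpow_mul hm,
    ← Real.sqrt_eq_rpow, ← Real.sqrt_eq_rpow, div_eq_mul_inv]

lemma epsTV_le (F : Set (X → ℝ)) (gen : A → Measure X) (μ : Measure X) (p : ℕ) (L Δ τ : ℝ)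
    (m : ℕ) (δ : ℝ) : epsTV F gen μ p L Δ τ m δ ≤
      √(complexityCoeff F gen μ * (approxError F gen μ + τ)) / 2 +
        √(complexityCoeff F gen μ * genConst p L Δ δ) / 2 * (m : ℝ) ^ (-(1 / 4) : ℝ) := by
  have e : complexityCoeff F gen μ * (epsF F gen μ p L Δ τ m δ / 2)
      = complexityCoeff F gen μ * (approxError F gen μ + τ)
        + complexityCoeff F gen μ * genConst p L Δ δ / √m := by
    rw [epsF]; ring
  have h := sqrt_add_le_sqrt_add_sqrt (complexityCoeff F gen μ * (approxError F gen μ + τ))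
    (complexityCoeff F gen μ * genConst p L Δ δ / √m)
  rw [sqrt_div_sqrt_natCast] at h
  rw [epsTV_eq, e]
  linarith

/-- The square root of a sequence of order `m ^ (-1/2)` has order `m ^ (-1/4)`. -/
lemma isBigO_sqrt_of_isBigO {u : ℕ → ℝ}
    (hu : u =O[atTop] fun m : ℕ => (m : ℝ) ^ (-(1 / 2) : ℝ)) :
    (fun m => √(u m)) =O[atTop] fun m : ℕ => (m : ℝ) ^ (-(1 / 4) : ℝ) := by
  obtain ⟨c, hc⟩ := hu.bound
  refine IsBigO.of_bound (√c) (hc.mono fun m hm => ?_)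
  have h0 : (0 : ℝ) ≤ m := Nat.cast_nonneg m
  have e : (m : ℝ) ^ (-(1 / 2) : ℝ) = 1 / √m := by
    rw [Real.rpow_neg h0, ← Real.sqrt_eq_rpow, one_div]
  rw [Real.norm_of_nonneg (Real.rpow_nonneg h0 _), e] at hm
  rw [Real.norm_of_nonneg (Real.sqrt_nonneg _), Real.norm_of_nonneg (Real.rpow_nonneg h0 _),
    ← sqrt_div_sqrt_natCast]
  refine Real.sqrt_le_sqrt ((le_abs_self _).trans (hm.trans_eq ?_))
  ring

end

end GANPrivacy

theorem mainTheorem5 {X A : Type*} [MeasurableSpace X]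
    -- the real distribution and the family of generated distributions
    (μ : Measure X) [IsProbabilityMeasure μ]
    (gen : A → Measure X) [∀ a, IsProbabilityMeasure (gen a)]
    -- the discriminator set `F = {f_θ : θ ∈ Θ}`, `Θ ⊆ [-1, 1]^p`
    (p : ℕ) (Θ : Set (EuclideanSpace ℝ (Fin p))) (f : EuclideanSpace ℝ (Fin p) → X → ℝ)
    (F : Set (X → ℝ)) (hF : F = f '' Θ)
    (hFmeas : ∀ h ∈ F, Measurable h)
    (hΘ : ∀ θ ∈ Θ, ∀ i, θ i ∈ Set.Icc (-1 : ℝ) 1)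
    (Δ L : ℝ) (hΔ : 0 ≤ Δ) (hL : 0 ≤ L)
    (hEven : ∀ h ∈ F, -h ∈ F)
    (hBdd : ∀ h ∈ F, ∀ x, |h x| ≤ Δ)
    (hLip : ∀ θ ∈ Θ, ∀ θ' ∈ Θ, ∀ x, |f θ x - f θ' x| ≤ L * ‖θ - θ'‖)
    -- log density ratios lie in the span of `F`, with bounded variation norm
    (hSpan : ∀ a, GANPrivacy.LogRatioInSpan F μ (gen a))
    (hΓ : BddAbove (Set.range fun a => GANPrivacy.variationNorm F μ (llr μ (gen a))))
    -- confidence level, and optimization error allowed at each sample size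
    (δ : ℝ) (hδ₀ : 0 < δ) (hδ₁ : δ ≤ 1)
    (τ : ℕ → ℝ) :
    -- the high-probability bound on the AUC of all attacks
    (∀ m : ℕ, 1 ≤ m → GANPrivacy.epsTV F gen μ p L Δ (τ m) m δ ≤ 1 →
      ∀ {Ω : Type*} [MeasurableSpace Ω] (P : Measure Ω) [IsProbabilityMeasure P]
        (S : Fin m → Ω → X) (α : Ω → A),
        (∀ i, Measurable (S i)) → iIndepFun S P → (∀ i, P.map (S i) = μ) →
        (∀ᵐ ω ∂P,
          GANPrivacy.ipm F (GANPrivacy.empiricalMeasure fun i => S i ω) (gen (α ω)) -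
            (⨅ a, GANPrivacy.ipm F (GANPrivacy.empiricalMeasure fun i => S i ω) (gen a)) ≤ τ m) →
        ∃ E : Set Ω, MeasurableSet E ∧ ENNReal.ofReal (1 - δ) ≤ P E ∧
          ∀ ω ∈ E, ∀ 𝒜 : GANPrivacy.AttackPolicy X,
            GANPrivacy.auc 𝒜 (GANPrivacy.trainPosterior μ (gen (α ω)) m) μ ≤
              GANPrivacy.aucBound (GANPrivacy.epsTV F gen μ p L Δ (τ m) m δ)) ∧
    -- the excess of the bound over `1/2`, for every sample size
    (∀ m : ℕ, 1 ≤ m →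
      GANPrivacy.aucBound (GANPrivacy.epsTV F gen μ p L Δ (τ m) m δ) - 1 / 2 ≤
        √(GANPrivacy.complexityCoeff F gen μ * (GANPrivacy.approxError F gen μ + τ m)) / 2 +
        √(GANPrivacy.complexityCoeff F gen μ * GANPrivacy.genConst p L Δ δ) / 2 *
          (m : ℝ) ^ (-(1 / 4) : ℝ)) ∧
    -- its decay rate when approximation and optimization errors are negligible
    ((fun m : ℕ => GANPrivacy.approxError F gen μ + τ m) =O[atTop]
        (fun m : ℕ => (m : ℝ) ^ (-(1 / 2) : ℝ)) →
      (fun m : ℕ => GANPrivacy.aucBound (GANPrivacy.epsTV F gen μ p L Δ (τ m) m δ) - 1 / 2) =O[atTop]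
        (fun m : ℕ => (m : ℝ) ^ (-(1 / 4) : ℝ))) := by
  have hBdd' : ∀ θ ∈ Θ, ∀ x, |f θ x| ≤ Δ := fun θ hθ => hBdd _ (hF ▸ Set.mem_image_of_mem f hθ)
  have hmeas' : ∀ θ ∈ Θ, Measurable (f θ) := fun θ hθ => hFmeas _ (hF ▸ Set.mem_image_of_mem f hθ)
  have hΓ0 := GANPrivacy.complexityCoeff_nonneg F gen μ
  have hexcess : ∀ ε : ℝ, GANPrivacy.aucBound ε - 1 / 2 = ε - ε ^ 2 / 2 := fun ε => by
    rw [GANPrivacy.aucBound]; ring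
  refine ⟨?_, fun m _ => ?_, fun hO => ?_⟩
  · intro m hm hε Ω _ P _ S α hS hindep hlaw hopt
    obtain ⟨E, hEm, hEP, hE⟩ := GANPrivacy.exists_measurableSet_deviation_le (μ := μ) hmeas' hΘ hL
      hBdd' hLip hm hδ₀ hδ₁
    have hmap : P.map (fun ω i => S i ω) = Measure.pi fun _ => μ := by
      rw [(iIndepFun_iff_map_fun_eq_pi_map fun i => (hS i).aemeasurable).1 hindep]
      simp_rw [hlaw]
    have hSm : Measurable fun ω i => S i ω := measurable_pi_iff.2 hS
    obtain ⟨N, hNsub, hNm, hN0⟩ := exists_measurable_superset_of_null hopt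
    refine ⟨(fun ω i => S i ω) ⁻¹' E \ N, (hSm hEm).diff hNm, ?_, fun ω hω 𝒜 => ?_⟩
    · rw [measure_sdiff_null hN0, ← Measure.map_apply hSm hEm, hmap]
      exact hEP
    have hoptω : GANPrivacy.ipm F (GANPrivacy.empiricalMeasure fun i => S i ω) (gen (α ω)) -
        (⨅ a, GANPrivacy.ipm F (GANPrivacy.empiricalMeasure fun i => S i ω) (gen a)) ≤ τ m := by
      by_contra hcon
      exact hω.2 (hNsub hcon)
    obtain ⟨hμν, hνμ, hne⟩ := hSpan (α ω)
    rw [GANPrivacy.trainPosterior_eq μ _ hμν hνμ hm]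
    refine GANPrivacy.auc_le_aucBound 𝒜 _ _ (GANPrivacy.epsTV_nonneg ..) hε fun φ => ?_
    -- `ε_F` may be negative when `F` is empty, so its positive part is used
    set D := GANPrivacy.epsF F gen μ p L Δ (τ m) m δ / 2 with hD
    obtain ⟨hiμ, hiν, hJ⟩ := GANPrivacy.integral_sub_integral_le_variationNorm_mul hνμ hFmeas hBdd
      (le_max_right D 0) (fun h hh => (GANPrivacy.abs_integral_sub_integral_le_epsF hFmeas hEven
        hBdd (fun g hg => by
          obtain ⟨θ, hθ, rfl⟩ := hF ▸ hg
          exact hE _ hω.1 θ hθ) hoptω hh).trans (le_max_left D 0)) hne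
    have hJΓ : (∫ x, llr μ (gen (α ω)) x ∂μ) - ∫ x, llr μ (gen (α ω)) x ∂gen (α ω)
        ≤ max (GANPrivacy.complexityCoeff F gen μ * D) 0 := by
      rw [← mul_zero (GANPrivacy.complexityCoeff F gen μ), ← mul_max_of_nonneg _ _ hΓ0]
      exact hJ.trans (mul_le_mul_of_nonneg_right (le_ciSup hΓ (α ω)) (le_max_right D 0))
    have hsqrt := Real.sqrt_le_sqrt hJΓ
    have hmax : ∀ y : ℝ, √(max y 0) = √y := fun y => by
      rcases le_total y 0 with h | h
      · rw [max_eq_right h, Real.sqrt_zero, Real.sqrt_eq_zero_of_nonpos h]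
      · rw [max_eq_left h]
    rw [hmax] at hsqrt
    rw [GANPrivacy.epsTV_eq]
    exact (GANPrivacy.rate_sub_rate_le μ _ hμν hνμ hiμ hiν φ).trans (by linarith)
  · rw [hexcess]
    exact (by linarith [sq_nonneg (GANPrivacy.epsTV F gen μ p L Δ (τ m) m δ)] :
      _ ≤ GANPrivacy.epsTV F gen μ p L Δ (τ m) m δ).trans (GANPrivacy.epsTV_le ..)
  · have hε : (fun m : ℕ => GANPrivacy.epsTV F gen μ p L Δ (τ m) m δ) =O[atTop]
        fun m : ℕ => (m : ℝ) ^ (-(1 / 4) : ℝ) := by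
      simp_rw [GANPrivacy.epsTV_eq]
      have hF2 : (fun m : ℕ => GANPrivacy.epsF F gen μ p L Δ (τ m) m δ / 2) =O[atTop]
          fun m : ℕ => (m : ℝ) ^ (-(1 / 2) : ℝ) := by
        have e : (fun m : ℕ => GANPrivacy.epsF F gen μ p L Δ (τ m) m δ / 2) = fun m : ℕ =>
            GANPrivacy.approxError F gen μ + τ m
              + GANPrivacy.genConst p L Δ δ * (m : ℝ) ^ (-(1 / 2) : ℝ) := by
          funext m
          rw [GANPrivacy.epsF, Real.rpow_neg (Nat.cast_nonneg m), ← Real.sqrt_eq_rpow]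
          ring
        rw [e]
        exact hO.add ((isBigO_refl _ _).const_mul_left _)
      have h2 := (GANPrivacy.isBigO_sqrt_of_isBigO
        (hF2.const_mul_left (GANPrivacy.complexityCoeff F gen μ))).const_mul_left (1 / 2)
      exact h2.congr_left fun m => by ring
    simp_rw [hexcess]
    -- `ε² ≤ const · ε`, because `ε` is bounded
    have hone : (fun m : ℕ => (m : ℝ) ^ (-(1 / 4) : ℝ)) =O[atTop] fun _ : ℕ => (1 : ℝ) :=
      ((tendsto_rpow_neg_atTop (by norm_num : (0 : ℝ) < 1 / 4)).comp
        tendsto_natCast_atTop_atTop).isBigO_one ℝ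
    have hsq : (fun m : ℕ => GANPrivacy.epsTV F gen μ p L Δ (τ m) m δ ^ 2 / 2) =O[atTop]
        fun m : ℕ => (m : ℝ) ^ (-(1 / 4) : ℝ) := by
      have h2 := ((hε.mul (hε.trans hone)).const_mul_left (1 / 2))
      simp only [mul_one] at h2
      exact h2.congr_left fun m => by ring
    exact hε.sub hsq
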